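/- Setting. Let $\mathcal X\subset\mathbb R^d$ be a nonempty closed convex set with $\|x-y\|\le D$ for all $x,y\in\mathcal X$ ($D>0$), let $r:\mathbb R^d\to\mathbb R$ be convex and lower semicontinuous, and let $F:\mathbb R^d\to\mathbb R^d$ be $L$-Lipschitz ($L>0$) and monotone on $\mathcal X$: $\langle F(x)-F(y),x-y\rangle\ge 0$ for $x,y\in\mathcal X$. Let $\mathsf Z$ be a Polish space with its Borel $\sigma$-field and $\mathrm Q$ a Markov kernel on it with unique invariant distribution $\pi$ and mixing time $\tau\in\mathbb N$, $\tau\ge1$, i.e. $\sup_{z,z'}\tfrac12\|\mathrm Q^k(z,\cdot)-\mathrm Q^k(z',\cdot)\|_{TV}\le(1/4)^{\lfloor k/\tau\rfloor}$ for all $k\in\mathbb N$. The oracle $F(x,z)$ is jointly measurable and satisfies $\mathbb E_{Z\sim\pi}[F(x,Z)]=F(x)$ for all $x\in\mathbb R^d$ and $\|F(x,z)-F(x)\|^2\le\sigma^2+\Delta^2\|x-x^*\|^2$ for all $z\in\mathsf Z$, $x\in\mathcal X$ ($\sigma,\Delta\ge0$), where $x^*\in\mathcal X$ is some solution of the variational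 inequality $\langle F(x^*),x-x^*\rangle+r(x)-r(x^*)\ge0$ for all $x\in\mathcal X$. Let $(Z_i)_{i\ge0}$ be a Markov chain with kernel $\mathrm Q$ (with any initial law, in particular stationary), and let $J_0,J_1,\dots$ be i.i.d. with $\mathbb P(J_k=j)=2^{-j}$, $j\ge1$, independent of $(Z_i)$. Algorithm (Randomized ExtraGradient). Given a stepsize $\gamma$, a number of iterations $N$, a batch size $B$, a batch limit $M$ and $x^0\in\mathcal X$, put $T^0=0$ and for $k=0,\dots,N-1$ $$x^{k+1/2}=\mathrm{prox}_{\gamma r}\Bigl(x^k-\gamma B^{-1}\sum_{i=1}^{B}F(x^k,Z_{T^k+i})\Bigr),\quad T^{k+1/2}=T^k+B,$$ $$g^k=g^k_0+\begin{cases}2^{J_k}(g^k_{J_k}-g^k_{J_k-1})&\text{if }2^{J_k}\le M,\\0&\text{otherwise,}\end{cases}\quad g^k_j=2^{-j}B^{-1}\sum_{i=1}^{2^jB}F(x^{k+1/2},Z_{T^{k+1/2}+i}),$$ $$x^{k+1}=\mathrm{prox}_{\gamma r}(x^k-\gamma g^k),\quad T^{k+1}=T^{k+1/2}+2^{J_k}B,$$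 where $\mathrm{prox}_{\gamma r}(x)=\arg\min_{y\in\mathcal X}\{\gamma r(y)+\tfrac12\|y-x\|^2\}$. Let $\bar x^N=\frac1N\sum_{k=0}^{N-1}x^{k+1/2}$ and $\mathrm{Gap}(x)=\sup_{y\in\mathcal X}[\langle F(y),x-y\rangle+r(x)-r(y)]$. An oracle call is one evaluation of $F(\cdot,\cdot)$: iteration $k$ makes $B+2^{J_k}B$ of them if $2^{J_k}\le M$ and $2B$ otherwise. Claim. Write $$m_N=\min\Bigl\{\frac1L,\sqrt{\frac{D^2}{(\sigma^2+\Delta^2D^2)N}}\Bigr\}$$ (with $m_N=1/L$ if $\sigma^2+\Delta^2D^2=0$) and $$A=\frac{LD^2}{\varepsilon}+\frac{\sigma^2D^2+\Delta^2D^4}{\varepsilon^2}.$$ There is an absolute $p\in\mathbb N$ such that for all constants $0<c_1\le c_2\le\frac13$ there is a constant $C>0$, depending only on $c_1,c_2$, with the following property. For all $L,D,\varepsilon>0$ and $\sigma,\Delta\ge0$ there is $N\ge1$ (depending only on $c_1,c_2,L,D,\sigma,\Delta,\varepsilon$) such that, for every problem as above, in any dimension and with any $\tau$, and for every $\gamma\in[c_1m_N,c_2m_N]$,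 the algorithm run for $N$ iterations with $B=\tau$ and $M=\sqrt N$ satisfies $\mathbb E[\mathrm{Gap}(\bar x^N)]\le\varepsilon$, and its expected number of oracle calls is at most $$C\,\tau\,\max\{1,A\}\,\log^p(2+A),$$ i.e. $\tilde{\mathcal O}\bigl(\tau\bigl[\frac{LD^2}{\varepsilon}+\frac{\sigma^2D^2+\Delta^2D^4}{\varepsilon^2}\bigr]\bigr)$ as soon as $A\ge1$, in particular if $\varepsilon\le LD^2$. -/

import Mathlib

open MeasureTheory ProbabilityTheory
open scoped ENNReal

noncomputable section

namespace MarkovVI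

/-- `ℝ^d` with its Euclidean norm. -/
abbrev Vec (d : ℕ) := EuclideanSpace ℝ (Fin d)

/-! ### Markov chains and their mixing time -/

section Chain

variable {S : Type*} [MeasurableSpace S]

/-- Total variation norm `‖μ - ν‖_TV = |μ - ν|(S)`; it is `2` for mutually singular
probability measures. -/
def tvNorm (μ ν : Measure S) [IsFiniteMeasure μ] [IsFiniteMeasure ν] : ℝ≥0∞ :=
  (μ.toSignedMeasure - ν.toSignedMeasure).totalVariation Set.univ

/-- Dobrushin coefficient `sup_{z, z'} (1/2) ‖κ(z, ·) - κ(z', ·)‖_TV`. -/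
def dobrushin (κ : Kernel S S) [IsMarkovKernel κ] : ℝ≥0∞ :=
  ⨆ (z : S) (z' : S), (1 / 2 : ℝ≥0∞) * tvNorm (κ z) (κ z')

instance isMarkovKernel_pow (κ : Kernel S S) [IsMarkovKernel κ] (k : ℕ) :
    IsMarkovKernel (κ ^ k) := by
  induction k with
  | zero => rw [pow_zero]; exact inferInstanceAs (IsMarkovKernel (Kernel.id : Kernel S S))
  | succ k ih => rw [pow_succ]; exact inferInstanceAs (IsMarkovKernel ((κ ^ k) ∘ₖ κ))

/-- `Q` has the unique invariant distribution `π` and is uniformly geometrically ergodic with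
mixing time `τ ≥ 1`. -/
structure UniformlyErgodic (Q : Kernel S S) [IsMarkovKernel Q] (π : Measure S) (τ : ℕ) :
    Prop where
  isProbabilityMeasure : IsProbabilityMeasure π
  invariant : Kernel.Invariant Q π
  unique : ∀ ρ : Measure S, IsProbabilityMeasure ρ → Kernel.Invariant Q ρ → ρ = π
  one_le : 1 ≤ τ
  mixing : ∀ k : ℕ, dobrushin (Q ^ k) ≤ (1 / 4 : ℝ≥0∞) ^ (k / τ)

variable {Ω : Type*} [MeasurableSpace Ω]

/-- `Z 0, Z 1, …` is a time-homogeneous Markov chain with transition kernel `Q`: given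
`Z 0, …, Z n`, the conditional law of `Z (n + 1)` is `Q (Z n)`. The law of `Z 0` is arbitrary. -/
structure IsMarkovChain (Q : Kernel S S) (P : Measure Ω) (Z : ℕ → Ω → S) : Prop where
  measurable : ∀ n, Measurable (Z n)
  condProb : ∀ n, ∀ A : Set S, MeasurableSet A →
    P⟦Z (n + 1) ⁻¹' A | ⨆ i ≤ n, MeasurableSpace.comap (Z i) inferInstance⟧
      =ᵐ[P] fun ω => (Q (Z n ω)).real A

/-- `J 0, J 1, …` are i.i.d. geometric with parameter `1/2` on `{1, 2, …}` and independent of the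
whole process `Z`. -/
structure IsGeometricSampling (P : Measure Ω) (J : ℕ → Ω → ℕ) (Z : ℕ → Ω → S) : Prop where
  measurable : ∀ k, Measurable (J k)
  law : ∀ k, ∀ j : ℕ, 1 ≤ j → P {ω | J k ω = j} = (1 / 2 : ℝ≥0∞) ^ j
  iIndep : iIndepFun J P
  indep : IndepFun (fun ω k => J k ω) (fun ω n => Z n ω) P

end Chain

/-! ### Monotone variational inequalities -/

/-- The data of a stochastic variational inequality: the feasible set, the operator `F(x)`, the
regularizer `r` and the oracle `F(x, z)`. -/
structure VIData (d : ℕ) (S : Type*) where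
  X : Set (Vec d)
  F : Vec d → Vec d
  r : Vec d → ℝ
  oracle : Vec d → S → Vec d

namespace VIData

variable {d : ℕ} {S : Type*}

/-- `x` solves the variational inequality. -/
def IsSolution (V : VIData d S) (x : Vec d) : Prop :=
  x ∈ V.X ∧ ∀ y ∈ V.X, 0 ≤ inner ℝ (V.F x) (y - x) + V.r y - V.r x

/-- `Gap(x) = sup_{y ∈ X} [⟨F(y), x - y⟩ + r(x) - r(y)]`. -/
def gap (V : VIData d S) (x : Vec d) : ℝ :=
  ⨆ y : V.X, (inner ℝ (V.F y) (x - y) + V.r x - V.r y)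

/-- The assumptions of the monotone setting, with Lipschitz constant `L`, diameter bound `D`, and
noise parameters `σ`, `Δ`. -/
structure MonotoneSetting [MeasurableSpace S] (V : VIData d S) (π : Measure S)
    (L D σ Δ : ℝ) : Prop where
  convex_X : Convex ℝ V.X
  closed_X : IsClosed V.X
  diam_X : ∀ x ∈ V.X, ∀ y ∈ V.X, ‖x - y‖ ^ 2 ≤ D ^ 2
  convex_r : ConvexOn ℝ Set.univ V.r
  lsc_r : LowerSemicontinuous V.r
  lipschitz : ∀ x ∈ V.X, ∀ y ∈ V.X, ‖V.F x - V.F y‖ ≤ L * ‖x - y‖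
  monotone : ∀ x ∈ V.X, ∀ y ∈ V.X, 0 ≤ inner ℝ (V.F x - V.F y) (x - y)
  measurable_oracle : Measurable (Function.uncurry V.oracle)
  integrable_oracle : ∀ x, Integrable (V.oracle x) π
  unbiased : ∀ x, ∫ z, V.oracle x z ∂π = V.F x
  noise : ∃ xstar, V.IsSolution xstar ∧
    ∀ z, ∀ x ∈ V.X, ‖V.oracle x z - V.F x‖ ^ 2 ≤ σ ^ 2 + Δ ^ 2 * ‖x - xstar‖ ^ 2

end VIData

/-! ### Randomized ExtraGradient -/

section Algorithm

variable {d : ℕ} {S : Type*}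

/-- `p` minimizes `y ↦ h(y) + (1/2) ‖y - x‖²` over `X`. -/
def IsProx (X : Set (Vec d)) (h : Vec d → ℝ) (x p : Vec d) : Prop :=
  p ∈ X ∧ ∀ y ∈ X, h p + 1 / 2 * ‖p - x‖ ^ 2 ≤ h y + 1 / 2 * ‖y - x‖ ^ 2

/-- `prox_h(x) = argmin_{y ∈ X} (h(y) + (1/2) ‖y - x‖²)`. The minimizer exists and is unique when
`X` is nonempty, closed and convex and `h` is convex and lower semicontinuous. -/
def prox (X : Set (Vec d)) (h : Vec d → ℝ) (x : Vec d) : Vec d :=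
  Classical.epsilon (IsProx X h x)

/-- `n⁻¹ ∑_{i=1}^{n} F(x, z_{T+i})`. -/
def batchMean (V : VIData d S) (z : ℕ → S) (x : Vec d) (T n : ℕ) : Vec d :=
  (n : ℝ)⁻¹ • ∑ i ∈ Finset.Icc 1 n, V.oracle x (z (T + i))

/-- The randomized estimate `g_0 + 2^j (g_j - g_{j-1})` if `2^j ≤ M`, and `g_0` otherwise, with
`g_i` the batch mean over the `2^i B` samples that follow time `T`. -/
def multilevelEstimate (V : VIData d S) (B : ℕ) (M : ℝ) (z : ℕ → S) (x : Vec d) (T j : ℕ) :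
    Vec d :=
  batchMean V z x T B +
    if (2 : ℝ) ^ j ≤ M then
      (2 : ℝ) ^ j • (batchMean V z x T (2 ^ j * B) - batchMean V z x T (2 ^ (j - 1) * B))
    else 0

/-- The extrapolation point `x^{k+1/2}` computed from `x^k = x` and `T^k = T`. -/
def halfStep (V : VIData d S) (γ : ℝ) (B : ℕ) (z : ℕ → S) (x : Vec d) (T : ℕ) : Vec d :=
  prox V.X (fun y => γ * V.r y) (x - γ • batchMean V z x T B)

/-- The pair `(x^k, T^k)` after `k` iterations started at `x0`, along the noise sequence `z` and
the levels `j`. -/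
def iterate (V : VIData d S) (γ : ℝ) (B : ℕ) (M : ℝ) (x0 : Vec d) (z : ℕ → S) (j : ℕ → ℕ) :
    ℕ → Vec d × ℕ
  | 0 => (x0, 0)
  | k + 1 =>
    let s := iterate V γ B M x0 z j k
    let xh := halfStep V γ B z s.1 s.2
    (prox V.X (fun y => γ * V.r y)
        (s.1 - γ • multilevelEstimate V B M z xh (s.2 + B) (j k)),
      s.2 + B + 2 ^ j k * B)

/-- The output `N⁻¹ ∑_{k=0}^{N-1} x^{k+1/2}`. -/
def averagedOutput (V : VIData d S) (γ : ℝ) (B : ℕ) (M : ℝ) (N : ℕ) (x0 : Vec d) (z : ℕ → S)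
    (j : ℕ → ℕ) : Vec d :=
  (N : ℝ)⁻¹ • ∑ k ∈ Finset.range N,
    halfStep V γ B z (iterate V γ B M x0 z j k).1 (iterate V γ B M x0 z j k).2

/-- The number of evaluations of the oracle during `N` iterations. Iteration `k` makes `B` of them
in the extrapolation step; the main step makes `2^{j_k} B` of them if `2^{j_k} ≤ M` (`g_0` and
`g_{j_k - 1}` reuse those of `g_{j_k}`), and `B` of them otherwise. -/
def oracleCalls (B : ℕ) (M : ℝ) (N : ℕ) (j : ℕ → ℕ) : ℕ :=
  ∑ k ∈ Finset.range N, (B + if (2 : ℝ) ^ j k ≤ M then 2 ^ j k * B else B)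

/-- `min {1/L, √(D² / ((σ² + Δ² D²) N))}`, the second term being `+∞` if `σ² + Δ² D² = 0`. -/
def stepScale (L D σ Δ : ℝ) (N : ℕ) : ℝ :=
  if σ ^ 2 + Δ ^ 2 * D ^ 2 = 0 then 1 / L
  else min (1 / L) (Real.sqrt (D ^ 2 / ((σ ^ 2 + Δ ^ 2 * D ^ 2) * N)))

/-- `L D² / ε + (σ² D² + Δ² D⁴) / ε²`. -/
def complexity (L D σ Δ ε : ℝ) : ℝ :=
  L * D ^ 2 / ε + (σ ^ 2 * D ^ 2 + Δ ^ 2 * D ^ 4) / ε ^ 2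

end Algorithm

end MarkovVI

end

open MeasureTheory ProbabilityTheory
open scoped ENNReal

noncomputable section

namespace MarkovVI

/-! ### Mixing: means of centred functions along the chain -/

section MarkovMoments

variable {S : Type*} [MeasurableSpace S]

/-! On the feasible set the oracle noise is at most `s = noiseLevel D σ Δ`, with `s² = σ² + Δ² D²`.
Let `ξ` be the error of the main-step estimate. The extragradient inequality with `γ L ≤ 1 / 3`
bounds the gap integrand at `y` by telescoping squares, squared errors, and `γ ⟨ξ, y - x^{k+1/2}⟩`.
The supremum over `y` sits inside the expectation, so `y` may depend on all the noise. An auxiliary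
sequence `u^k` (`ghost`), moved by projected steps along the errors, resolves this: `⟨ξ, y - u^k⟩`
obeys a regret bound uniform in `y`, and `⟨ξ, u^k - x^{k+1/2}⟩` pairs `ξ` with a vector known before
the main batch is drawn. `gap_averagedOutput_le` is the resulting bound along each path.

Two moments of `ξ` remain. The levels are independent of the chain, so they may be frozen; the
sampling times are then deterministic and the iterates adapted. Geometric mixing gives a batch mean
of `n` samples bias and variance of order `τ / n`. In the multilevel estimate the weight `2^j`
cancels the probability `2^{-j}`, so its mean telescopes to that of the largest batch, with bias of
order `s / 2^m` (`abs_integral_inner_levelError_le`). The second moment gains only a factor `1 + m`: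
each level contributes `2^{-j} 4^j 2^{-j}`, up to constants (`integral_norm_sq_levelError_le`).

With `N = 4^q` and `M = 2^q` the largest level is `m = q`, and the expected gap is of order `L D² /
N + (1 + q) s D / √N`. The least `q` for which `4^q` exceeds a multiple of `max 1 A * (1 + q)²`
makes this at most `ε`. The expected cost is at most `τ N (3 + q)`, whence three logarithms
(`exists_exponent`). -/

/-- A measurable function bounded by `K` changes its mean by at most `K` times the total variation
distance. -/
theorem abs_integral_sub_le_tvNorm (μ ν : Measure S) [IsFiniteMeasure μ] [IsFiniteMeasure ν]
    {f : S → ℝ} (hf : Measurable f) {K : ℝ} (hK : ∀ z, |f z| ≤ K) :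
    |∫ z, f z ∂μ - ∫ z, f z ∂ν| ≤ K * (tvNorm μ ν).toReal := by
  set s := μ.toSignedMeasure - ν.toSignedMeasure with hs
  set p := s.toJordanDecomposition.posPart
  set n := s.toJordanDecomposition.negPart
  -- The Jordan decomposition of `μ - ν`, rearranged into an identity between positive measures so
  -- that it can be integrated against.
  have hsum : μ + n = ν + p := by
    ext A hA
    have h1 : s A = p.real A - n.real A := by
      conv_lhs => rw [← SignedMeasure.toSignedMeasure_toJordanDecomposition s]
      exact Measure.toSignedMeasure_sub_apply hA
    rw [hs, Measure.toSignedMeasure_sub_apply hA] at h1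
    rw [Measure.add_apply, Measure.add_apply,
      ← ENNReal.toReal_eq_toReal_iff' (by simp) (by simp),
      ENNReal.toReal_add (by simp) (by simp), ENNReal.toReal_add (by simp) (by simp)]
    simp only [Measure.real] at h1
    linarith
  have hint : ∀ ρ : Measure S, IsFiniteMeasure ρ → Integrable f ρ := fun ρ _ =>
    Integrable.of_bound hf.aestronglyMeasurable K (ae_of_all _ hK)
  have hb : ∀ ρ : Measure S, IsFiniteMeasure ρ → |∫ z, f z ∂ρ| ≤ K * ρ.real Set.univ :=
    fun ρ _ => norm_integral_le_of_norm_le_const (f := f) (ae_of_all _ hK)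
  have h2 := congrArg (fun ρ => ∫ z, f z ∂ρ) hsum
  rw [integral_add_measure (hint _ inferInstance) (hint _ inferInstance),
    integral_add_measure (hint _ inferInstance) (hint _ inferInstance)] at h2
  have htv : (tvNorm μ ν).toReal = p.real Set.univ + n.real Set.univ := by
    rw [tvNorm, SignedMeasure.totalVariation, Measure.add_apply,
      ENNReal.toReal_add (by simp) (by simp)]
    rfl
  have e : ∫ z, f z ∂μ - ∫ z, f z ∂ν = ∫ z, f z ∂p - ∫ z, f z ∂n := by linarith
  rw [e, htv, mul_add]
  exact (abs_sub _ _).trans (add_le_add (hb p inferInstance) (hb n inferInstance))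

theorem integral_measure_bind {T E : Type*} [MeasurableSpace T] [NormedAddCommGroup E]
    [NormedSpace ℝ E] {μ : Measure S} {κ : Kernel S T}
    {f : T → E} (hf : Integrable f (μ.bind κ)) :
    ∫ y, f y ∂(μ.bind κ) = ∫ x, ∫ y, f y ∂(κ x) ∂μ := by
  have h : (κ ∘ₖ Kernel.const Unit μ) () = μ.bind κ := by
    rw [Kernel.comp_apply, Kernel.const_apply]
  have := Kernel.integral_comp (η := κ) (κ := Kernel.const Unit μ) (a := ()) (f := f)
    (by rw [h]; exact hf)
  rwa [h, Kernel.const_apply] at this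

theorem UniformlyErgodic.invariant_pow {Q : Kernel S S} [IsMarkovKernel Q] {π : Measure S}
    {τ : ℕ} (h : UniformlyErgodic Q π τ) (k : ℕ) : Kernel.Invariant (Q ^ k) π := by
  induction k with
  | zero =>
    rw [pow_zero]
    change π.bind (Kernel.id : Kernel S S) = π
    exact Measure.id_comp
  | succ k ih => rw [pow_succ]; exact ih.comp h.invariant

/-- After `k` steps from any starting point, the mean of a bounded function that is centred under
the invariant distribution is geometrically small. -/
theorem UniformlyErgodic.abs_integral_pow_le {Q : Kernel S S} [IsMarkovKernel Q] {π : Measure S}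
    {τ : ℕ} (h : UniformlyErgodic Q π τ) {f : S → ℝ} (hf : Measurable f) {K : ℝ}
    (hK : ∀ z, |f z| ≤ K) (h0 : ∫ z, f z ∂π = 0) (k : ℕ) (z : S) :
    |∫ y, f y ∂((Q ^ k) z)| ≤ 2 * K * (1 / 4) ^ (k / τ) := by
  have := h.isProbabilityMeasure
  have hK0 : 0 ≤ K := (abs_nonneg _).trans (hK z)
  have hint : ∀ ρ : Measure S, IsFiniteMeasure ρ → Integrable f ρ := fun ρ _ =>
    Integrable.of_bound hf.aestronglyMeasurable K (ae_of_all _ hK)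
  -- By invariance the mean vanishes once the starting point is averaged over `π`; it then suffices
  -- to compare `z` with each `z'`.
  have hπ : ∫ z', ∫ y, f y ∂((Q ^ k) z') ∂π = 0 := by
    rw [← integral_measure_bind (hint _ inferInstance), (h.invariant_pow k).def, h0]
  have htv : ∀ z', (tvNorm ((Q ^ k) z) ((Q ^ k) z')).toReal ≤ 2 * (1 / 4) ^ (k / τ) := by
    intro z'
    have h1 : (1 / 2 : ℝ≥0∞) * tvNorm ((Q ^ k) z) ((Q ^ k) z') ≤ (1 / 4) ^ (k / τ) :=
      (le_iSup₂ (f := fun z z' => (1 / 2 : ℝ≥0∞) * tvNorm ((Q ^ k) z) ((Q ^ k) z')) z z').trans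
        (h.mixing k)
    have h2 := ENNReal.toReal_mono (by simp) h1
    rw [ENNReal.toReal_mul, ENNReal.toReal_pow] at h2
    norm_num at h2 ⊢
    linarith
  have hm : StronglyMeasurable fun z' => ∫ y, f y ∂((Q ^ k) z') :=
    hf.stronglyMeasurable.integral_kernel
  have hi : Integrable (fun z' => ∫ y, f y ∂((Q ^ k) z')) π :=
    Integrable.of_bound hm.aestronglyMeasurable K (ae_of_all _ fun z' => by
      simpa using norm_integral_le_of_norm_le_const (f := f) (μ := (Q ^ k) z') (ae_of_all _ hK))
  have e : ∫ y, f y ∂((Q ^ k) z)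
      = ∫ z', (∫ y, f y ∂((Q ^ k) z) - ∫ y, f y ∂((Q ^ k) z')) ∂π := by
    rw [integral_sub (integrable_const _) hi, hπ]; simp
  rw [e]
  have := norm_integral_le_of_norm_le_const (μ := π)
    (f := fun z' => ∫ y, f y ∂((Q ^ k) z) - ∫ y, f y ∂((Q ^ k) z'))
    (C := 2 * K * (1 / 4) ^ (k / τ)) (ae_of_all _ fun z' => by
      refine (abs_integral_sub_le_tvNorm _ _ hf hK).trans ?_
      nlinarith [htv z'])
  simpa using this

section Past

variable {Ω : Type*}

/-- The `σ`-algebra generated by `Z 0, …, Z n`. -/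
abbrev past (Z : ℕ → Ω → S) (n : ℕ) : MeasurableSpace Ω :=
  ⨆ i ≤ n, MeasurableSpace.comap (Z i) inferInstance

theorem past_mono (Z : ℕ → Ω → S) {m n : ℕ} (h : m ≤ n) : past Z m ≤ past Z n :=
  biSup_mono fun _ hi => hi.trans h

theorem measurable_past (Z : ℕ → Ω → S) {i n : ℕ} (h : i ≤ n) : Measurable[past Z n] (Z i) :=
  (Measurable.of_comap_le (le_refl _)).mono
    (le_iSup₂ (f := fun i (_ : i ≤ n) => MeasurableSpace.comap (Z i) inferInstance) i h) le_rfl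

end Past

variable {Ω : Type*} [MeasurableSpace Ω]

theorem IsMarkovChain.past_le {Q : Kernel S S} {P : Measure Ω} {Z : ℕ → Ω → S}
    (hZ : IsMarkovChain Q P Z) (n : ℕ) :
    past Z n ≤ ‹MeasurableSpace Ω› :=
  iSup₂_le fun i _ => (hZ.measurable i).comap_le

variable {Q : Kernel S S} [IsMarkovKernel Q] {P : Measure Ω} [IsProbabilityMeasure P]
  {Z : ℕ → Ω → S}

/-- Both sides agree on rectangles `A ×ˢ B`, where the identity is the conditional law of `Z (n +
1)` integrated over the past event `h ∈ A`. In this kernel form the Markov property iterates by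
composition. -/
theorem IsMarkovChain.map_prod_succ (hZ : IsMarkovChain Q P Z) {H : Type*} [MeasurableSpace H]
    {n : ℕ} {h : Ω → H} (hh : Measurable[past Z n] h) :
    P.map (fun ω => (h ω, Z (n + 1) ω))
      = (P.map fun ω => (h ω, Z n ω)).bind (Kernel.id ∥ₖ Q) := by
  have hh' : Measurable h := hh.mono (hZ.past_le n) le_rfl
  have hp : ∀ m, Measurable fun ω => (h ω, Z m ω) := fun m => hh'.prodMk (hZ.measurable m)
  have : IsProbabilityMeasure (P.map fun ω => (h ω, Z (n + 1) ω)) :=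
    Measure.isProbabilityMeasure_map (hp _).aemeasurable
  refine Measure.ext_prod fun {A B} hA hB => ?_
  rw [Measure.map_apply (hp _) (hA.prod hB), Measure.bind_apply (hA.prod hB) (by fun_prop),
    lintegral_map (Kernel.measurable_coe _ (hA.prod hB)) (hp _)]
  simp only [Kernel.parallelComp_apply_prod, Kernel.id_apply]
  have hA' : MeasurableSet[past Z n] (h ⁻¹' A) := hh hA
  have hAm : MeasurableSet (h ⁻¹' A) := hh' hA
  have hBm : MeasurableSet (Z (n + 1) ⁻¹' B) := hZ.measurable _ hB
  have key := setIntegral_condExp (μ := P) (hZ.past_le n)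
    (f := (Z (n + 1) ⁻¹' B).indicator fun _ => (1 : ℝ))
    ((integrable_const _).indicator hBm) hA'
  rw [setIntegral_congr_ae (g := fun ω => (Q (Z n ω)).real B) hAm
    ((hZ.condProb n B hB).mono fun ω hω _ => hω), integral_indicator hBm,
    Measure.restrict_restrict hBm] at key
  have hQm : Measurable fun ω => Q (Z n ω) B := (Kernel.measurable_coe Q hB).comp (hZ.measurable n)
  have e1 : ∫ ω in h ⁻¹' A, (Q (Z n ω)).real B ∂P
      = (∫⁻ ω in h ⁻¹' A, Q (Z n ω) B ∂P).toReal :=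
    integral_toReal hQm.aemeasurable (ae_of_all _ fun ω => measure_lt_top _ _)
  rw [e1] at key
  simp only [integral_const, MeasurableSet.univ, measureReal_restrict_apply, Set.univ_inter,
    smul_eq_mul, mul_one] at key
  have hfin : ∫⁻ ω in h ⁻¹' A, Q (Z n ω) B ∂P ≠ ∞ := by
    refine ((lintegral_mono (g := fun _ => 1) fun ω => prob_le_one).trans_lt ?_).ne
    simp
  have key' := (ENNReal.toReal_eq_toReal_iff' hfin (measure_ne_top _ _)).1 key
  have hset : (fun ω => (h ω, Z (n + 1) ω)) ⁻¹' A ×ˢ B = Z (n + 1) ⁻¹' B ∩ h ⁻¹' A := by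
    ext ω; simp [and_comm]
  rw [hset, ← key', ← lintegral_indicator hAm]
  refine lintegral_congr fun ω => ?_
  by_cases hω : h ω ∈ A
  · simp [Measure.dirac_apply' _ hA, hω]
  · simp [Measure.dirac_apply' _ hA, hω]

theorem IsMarkovChain.map_prod_add (hZ : IsMarkovChain Q P Z) {H : Type*} [MeasurableSpace H]
    {n : ℕ} {h : Ω → H} (hh : Measurable[past Z n] h) (k : ℕ) :
    P.map (fun ω => (h ω, Z (n + k) ω))
      = (P.map fun ω => (h ω, Z n ω)).bind (Kernel.id ∥ₖ (Q ^ k)) := by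
  induction k with
  | zero =>
    have : (Kernel.id ∥ₖ (Q ^ 0) : Kernel (H × S) (H × S)) = Kernel.id := by
      rw [pow_zero]; exact Kernel.id_parallelComp_id
    rw [this, Measure.id_comp, add_zero]
  | succ k ih =>
    have h1 := hZ.map_prod_succ (hh.mono (past_mono Z (Nat.le_add_right n k)) le_rfl)
    rw [ih, Measure.comp_assoc, Kernel.parallelComp_comp_parallelComp, Kernel.id_comp] at h1
    rw [pow_succ']
    exact h1

/-- If `f (h, ·)` is bounded by `K` and centred under the invariant distribution for each value `h`
of a variable that depends on the past only, then `f (h, Z (n + k))` has a geometrically small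
mean. -/
theorem IsMarkovChain.abs_integral_le (hZ : IsMarkovChain Q P Z) {π : Measure S} {τ : ℕ}
    (hQ : UniformlyErgodic Q π τ) {H : Type*} [MeasurableSpace H]
    {n : ℕ} {h : Ω → H} (hh : Measurable[past Z n] h) {f : H → S → ℝ}
    (hf : Measurable (Function.uncurry f)) {K : ℝ} (hK : ∀ a z, |f a z| ≤ K)
    (h0 : ∀ a, ∫ z, f a z ∂π = 0) (k : ℕ) :
    |∫ ω, f (h ω) (Z (n + k) ω) ∂P| ≤ 2 * K * (1 / 4) ^ (k / τ) := by
  have hh' : Measurable h := hh.mono (hZ.past_le n) le_rfl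
  have hp : ∀ m, Measurable fun ω => (h ω, Z m ω) := fun m => hh'.prodMk (hZ.measurable m)
  have : IsProbabilityMeasure (P.map fun ω => (h ω, Z n ω)) :=
    Measure.isProbabilityMeasure_map (hp _).aemeasurable
  have e : ∫ ω, f (h ω) (Z (n + k) ω) ∂P
      = ∫ y, Function.uncurry f y ∂((P.map fun ω => (h ω, Z n ω)).bind
          ((Kernel.id : Kernel H H) ∥ₖ (Q ^ k))) := by
    rw [← hZ.map_prod_add hh k, integral_map (hp _).aemeasurable hf.aestronglyMeasurable]
    rfl
  rw [e, integral_measure_bind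
    (Integrable.of_bound hf.aestronglyMeasurable K (ae_of_all _ fun y => hK y.1 y.2))]
  have := norm_integral_le_of_norm_le_const (μ := P.map fun ω => (h ω, Z n ω))
    (f := fun x => ∫ y, Function.uncurry f y ∂((Kernel.id ∥ₖ (Q ^ k)) x))
    (C := 2 * K * (1 / 4) ^ (k / τ)) (ae_of_all _ fun x => by
      rw [Kernel.parallelComp_apply, Kernel.id_apply, Measure.dirac_prod,
        integral_map (by fun_prop) hf.aestronglyMeasurable]
      exact hQ.abs_integral_pow_le (hf.comp measurable_prodMk_left) (hK x.1) (h0 x.1) k x.2)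
  simpa using this

end MarkovMoments

/-! ### Proximal steps and the extragradient inequality -/

section Prox

variable {d : ℕ} {X : Set (Vec d)} {h : Vec d → ℝ}

theorem isProx_prox (hX : IsCompact X) (hne : X.Nonempty) (hh : Continuous h) (x : Vec d) :
    IsProx X h x (prox X h x) := by
  refine Classical.epsilon_spec (p := IsProx X h x) ?_
  obtain ⟨p, hp, hmin⟩ := hX.exists_isMinOn hne
    (f := fun y => h y + 1 / 2 * ‖y - x‖ ^ 2) (by fun_prop)
  exact ⟨p, hp, fun y hy => hmin hy⟩

/-- The variational characterization of the proximal point. -/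
theorem IsProx.inner_le (hX : Convex ℝ X) (hh : ConvexOn ℝ Set.univ h) {x p : Vec d}
    (hp : IsProx X h x p) {y : Vec d} (hy : y ∈ X) :
    h p + inner ℝ (p - x) (p - y) ≤ h y := by
  -- Minimality of `p` is tested at a point of the segment from `p` to `y`, the inequality is
  -- divided by `t`, and then `t` tends to `0`.
  have key : ∀ t : ℝ, 0 < t → t ≤ 1 →
      h p + inner ℝ (p - x) (p - y) ≤ h y + t * (1 / 2 * ‖y - p‖ ^ 2) := by
    intro t ht0 ht1
    have hmem : (1 - t) • p + t • y ∈ X := hX hp.1 hy (by linarith) ht0.le (by ring)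
    have h1 := hp.2 _ hmem
    have h2 := hh.2 (Set.mem_univ p) (Set.mem_univ y) (show 0 ≤ 1 - t by linarith) ht0.le (by ring)
    have e : (1 - t) • p + t • y - x = (p - x) + t • (y - p) := by
      rw [sub_smul, smul_sub, one_smul]; abel
    rw [e, norm_add_sq_real, inner_smul_right, norm_smul, Real.norm_of_nonneg ht0.le] at h1
    have e2 : inner ℝ (p - x) (y - p) = - inner ℝ (p - x) (p - y) := by
      rw [← inner_neg_right, neg_sub]
    rw [e2] at h1
    simp only [smul_eq_mul] at h2
    have h3 : t * (h p + inner ℝ (p - x) (p - y)) ≤ t * (h y + t * (1 / 2 * ‖y - p‖ ^ 2)) := by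
      nlinarith
    exact le_of_mul_le_mul_left h3 ht0
  refine le_of_forall_pos_le_add fun ε hε => ?_
  set c := 1 / 2 * ‖y - p‖ ^ 2
  have hc : 0 ≤ c := by positivity
  have ht : 0 < min 1 (ε / (c + 1)) := lt_min one_pos (by positivity)
  refine (key _ ht (min_le_left _ _)).trans (add_le_add le_rfl ?_)
  calc min 1 (ε / (c + 1)) * c ≤ ε / (c + 1) * (c + 1) :=
        mul_le_mul (min_le_right _ _) (by linarith) hc (by positivity)
    _ = ε := by field_simp

/-- Add the variational inequalities at the two points. Nonexpansiveness serves to make `prox`,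
which is defined by choice, continuous and hence measurable. -/
theorem norm_prox_sub_prox_le (hX : IsCompact X) (hXc : Convex ℝ X) (hne : X.Nonempty)
    (hh : Continuous h) (hc : ConvexOn ℝ Set.univ h) (x y : Vec d) :
    ‖prox X h x - prox X h y‖ ≤ ‖x - y‖ := by
  have hp := isProx_prox hX hne hh x
  have hq := isProx_prox hX hne hh y
  set p := prox X h x
  set q := prox X h y
  have h1 := hp.inner_le hXc hc hq.1
  have h2 := hq.inner_le hXc hc hp.1
  have h3 : ‖p - q‖ ^ 2 = inner ℝ (x - y) (p - q) + inner ℝ (p - x) (p - q)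
      + inner ℝ (q - y) (q - p) := by
    rw [← neg_sub p q, inner_neg_right, ← sub_eq_add_neg, ← inner_add_left, ← inner_sub_left,
      ← real_inner_self_eq_norm_sq]
    congr 1; abel
  have h4 := real_inner_le_norm (x - y) (p - q)
  by_contra hlt
  push Not at hlt
  nlinarith [norm_nonneg (x - y), norm_nonneg (p - q)]

theorem continuous_prox (hX : IsCompact X) (hXc : Convex ℝ X) (hne : X.Nonempty)
    (hh : Continuous h) (hc : ConvexOn ℝ Set.univ h) : Continuous (prox X h) :=
  (LipschitzWith.of_dist_le_mul (K := 1) fun x y => by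
    simpa [dist_eq_norm] using norm_prox_sub_prox_le hX hXc hne hh hc x y).continuous

/-- The projected step `u⁺ = proj_X (u + v)` satisfies the regret inequality. -/
theorem IsProx.regret_le (hX : Convex ℝ X) {u v p y : Vec d}
    (hp : IsProx X (fun _ => 0) (u + v) p) (hy : y ∈ X) :
    inner ℝ v (y - u) ≤ 1 / 2 * ‖u - y‖ ^ 2 - 1 / 2 * ‖p - y‖ ^ 2 + 1 / 2 * ‖v‖ ^ 2 := by
  have h1 := hp.inner_le hX (convexOn_const 0 convex_univ) hy
  simp only [zero_add] at h1
  have h2 : ‖u - y + v‖ ^ 2 = ‖u - y‖ ^ 2 + 2 * inner ℝ (u - y) v + ‖v‖ ^ 2 := norm_add_sq_real _ _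
  have e2 : u - y + v = (p - y) - (p - (u + v)) := by abel
  have h3 := norm_sub_sq_real (p - y) (p - (u + v))
  rw [← e2, real_inner_comm] at h3
  have e3 : inner ℝ v (y - u) = - inner ℝ (u - y) v := by
    rw [real_inner_comm, ← inner_neg_left, neg_sub]
  nlinarith [sq_nonneg ‖p - (u + v)‖]

/-- One step of the extragradient method, with update directions `b` and `g`. -/
theorem extragradient_step (hX : Convex ℝ X) {r : Vec d → ℝ} {γ : ℝ}
    (hr : ConvexOn ℝ Set.univ fun y => γ * r y) {x b g p q y : Vec d}
    (hp : IsProx X (fun y => γ * r y) (x - γ • b) p)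
    (hq : IsProx X (fun y => γ * r y) (x - γ • g) q) (hy : y ∈ X) :
    γ * (inner ℝ g (p - y) + r p - r y) ≤
      1 / 2 * ‖x - y‖ ^ 2 - 1 / 2 * ‖q - y‖ ^ 2 - 1 / 2 * ‖p - x‖ ^ 2
        + 1 / 2 * γ ^ 2 * ‖g - b‖ ^ 2 := by
  have h1 := hq.inner_le hX hr hy
  have h2 := hp.inner_le hX hr hq.1
  have e1 : inner ℝ (q - (x - γ • g)) (q - y) = inner ℝ (q - x) (q - y) + γ * inner ℝ g (q - y) := by
    rw [← real_inner_smul_left, ← inner_add_left]; congr 1; abel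
  have e2 : inner ℝ (p - (x - γ • b)) (p - q) = inner ℝ (p - x) (p - q) + γ * inner ℝ b (p - q) := by
    rw [← real_inner_smul_left, ← inner_add_left]; congr 1; abel
  have e3 : inner ℝ g (p - y) = inner ℝ g (p - q) + inner ℝ g (q - y) := by
    rw [← inner_add_right]; congr 1; abel
  have e4 : inner ℝ (g - b) (p - q) = inner ℝ g (p - q) - inner ℝ b (p - q) := inner_sub_left _ _ _
  have e5 : ‖x - y‖ ^ 2 = ‖q - y‖ ^ 2 - 2 * inner ℝ (q - x) (q - y) + ‖q - x‖ ^ 2 := by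
    rw [real_inner_comm, ← norm_sub_sq_real]; congr 2; abel
  have e6 : ‖q - x‖ ^ 2 = ‖p - x‖ ^ 2 - 2 * inner ℝ (p - x) (p - q) + ‖p - q‖ ^ 2 := by
    rw [← norm_sub_sq_real]; congr 2; abel
  -- Young's inequality for `γ ⟨g - b, p - q⟩`; the resulting `1 / 2 * ‖p - q‖ ^ 2` cancels against
  -- the one in `e6`.
  have h3 : 0 ≤ ‖γ • (g - b) - (p - q)‖ ^ 2 := sq_nonneg _
  rw [norm_sub_sq_real, real_inner_smul_left, norm_smul, mul_pow, Real.norm_eq_abs, sq_abs] at h3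
  rw [e1] at h1
  rw [e2] at h2
  rw [e4] at h3
  rw [e3]
  nlinarith

end Prox

/-! ### Bounds along a single path -/

section Setting

variable {d : ℕ} {S : Type*}

/-- A bound `√(σ² + Δ² D²)` on the noise of the oracle on the feasible set. -/
def noiseLevel (D σ Δ : ℝ) : ℝ := Real.sqrt (σ ^ 2 + Δ ^ 2 * D ^ 2)

theorem noiseLevel_nonneg (D σ Δ : ℝ) : 0 ≤ noiseLevel D σ Δ := Real.sqrt_nonneg _

theorem noiseLevel_sq (D σ Δ : ℝ) : noiseLevel D σ Δ ^ 2 = σ ^ 2 + Δ ^ 2 * D ^ 2 :=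
  Real.sq_sqrt (by positivity)

theorem batchMean_sub (V : VIData d S) (z : ℕ → S) (x : Vec d) (T : ℕ) {n : ℕ} (hn : 1 ≤ n) :
    batchMean V z x T n - V.F x
      = (n : ℝ)⁻¹ • ∑ i ∈ Finset.Icc 1 n, (V.oracle x (z (T + i)) - V.F x) := by
  have : (n : ℝ) ≠ 0 := by positivity
  rw [batchMean, Finset.sum_sub_distrib, smul_sub, Finset.sum_const, Nat.card_Icc,
    Nat.add_sub_cancel, ← Nat.cast_smul_eq_nsmul ℝ, smul_smul, inv_mul_cancel₀ this, one_smul]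

namespace VIData.MonotoneSetting

variable [MeasurableSpace S] {V : VIData d S} {π : Measure S} {L D σ Δ : ℝ}

theorem nonempty_X (hV : V.MonotoneSetting π L D σ Δ) : V.X.Nonempty := by
  obtain ⟨x, hx, -⟩ := hV.noise
  exact ⟨x, hx.1⟩

theorem isCompact_X (hV : V.MonotoneSetting π L D σ Δ) : IsCompact V.X := by
  refine Metric.isCompact_of_isClosed_isBounded hV.closed_X
    (Metric.isBounded_iff.2 ⟨|D|, fun x hx y hy => ?_⟩)
  rw [dist_eq_norm]
  exact abs_le_of_sq_le_sq' (by rw [sq_abs]; exact hV.diam_X x hx y hy) (abs_nonneg _) |>.2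

theorem continuous_r (hV : V.MonotoneSetting π L D σ Δ) : Continuous V.r :=
  hV.convex_r.locallyLipschitz.continuous

theorem convexOn_mul_r (hV : V.MonotoneSetting π L D σ Δ) {γ : ℝ} (hγ : 0 ≤ γ) :
    ConvexOn ℝ Set.univ fun y => γ * V.r y :=
  hV.convex_r.smul hγ

theorem isProx_prox (hV : V.MonotoneSetting π L D σ Δ) (γ : ℝ) (x : Vec d) :
    IsProx V.X (fun y => γ * V.r y) x (prox V.X (fun y => γ * V.r y) x) :=
  MarkovVI.isProx_prox hV.isCompact_X hV.nonempty_X (hV.continuous_r.const_mul γ) x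

theorem isProx_proj (hV : V.MonotoneSetting π L D σ Δ) (x : Vec d) :
    IsProx V.X (fun _ => 0) x (prox V.X (fun _ => 0) x) :=
  MarkovVI.isProx_prox hV.isCompact_X hV.nonempty_X continuous_const x

theorem measurable_prox (hV : V.MonotoneSetting π L D σ Δ) {γ : ℝ} (hγ : 0 ≤ γ) :
    Measurable (prox V.X fun y => γ * V.r y) :=
  (continuous_prox hV.isCompact_X hV.convex_X hV.nonempty_X (hV.continuous_r.const_mul γ)
    (hV.convexOn_mul_r hγ)).measurable

theorem measurable_proj (hV : V.MonotoneSetting π L D σ Δ) :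
    Measurable (prox V.X fun _ => 0) :=
  (continuous_prox hV.isCompact_X hV.convex_X hV.nonempty_X continuous_const
    (convexOn_const 0 convex_univ)).measurable

theorem norm_oracle_sub_le (hV : V.MonotoneSetting π L D σ Δ) {x : Vec d} (hx : x ∈ V.X) (z : S) :
    ‖V.oracle x z - V.F x‖ ≤ noiseLevel D σ Δ := by
  obtain ⟨xs, hs, hn⟩ := hV.noise
  refine Real.le_sqrt_of_sq_le ((hn z x hx).trans ?_)
  have := mul_le_mul_of_nonneg_left (hV.diam_X x hx xs hs.1) (sq_nonneg Δ)
  linarith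

theorem norm_batchMean_sub_le (hV : V.MonotoneSetting π L D σ Δ) {x : Vec d} (hx : x ∈ V.X)
    (z : ℕ → S) (T : ℕ) {n : ℕ} (hn : 1 ≤ n) :
    ‖batchMean V z x T n - V.F x‖ ≤ noiseLevel D σ Δ := by
  have hn0 : (0 : ℝ) < n := by positivity
  rw [batchMean_sub V z x T hn, norm_smul, norm_inv, Real.norm_of_nonneg hn0.le,
    inv_mul_le_iff₀ hn0]
  refine (norm_sum_le_of_le _ fun i _ => hV.norm_oracle_sub_le hx _).trans ?_
  simp

theorem norm_sub_le (hV : V.MonotoneSetting π L D σ Δ) (hD : 0 ≤ D) {x y : Vec d} (hx : x ∈ V.X)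
    (hy : y ∈ V.X) : ‖x - y‖ ≤ D :=
  abs_le_of_sq_le_sq' (hV.diam_X x hx y hy) hD |>.2

end VIData.MonotoneSetting

section Path

variable (V : VIData d S) (γ : ℝ) (B : ℕ) (M : ℝ) (x0 : Vec d) (z : ℕ → S) (j : ℕ → ℕ)

/-- The extrapolation point of iteration `k`. -/
def halfIterate (k : ℕ) : Vec d :=
  halfStep V γ B z (iterate V γ B M x0 z j k).1 (iterate V γ B M x0 z j k).2

/-- The error of the randomized estimate in iteration `k`. -/
def levelError (k : ℕ) : Vec d :=
  multilevelEstimate V B M z (halfIterate V γ B M x0 z j k)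
    ((iterate V γ B M x0 z j k).2 + B) (j k) - V.F (halfIterate V γ B M x0 z j k)

/-- The auxiliary sequence obtained by projected steps along the errors of the estimates. -/
def ghost : ℕ → Vec d
  | 0 => x0
  | k + 1 => prox V.X (fun _ => 0) (ghost k + γ • levelError V γ B M x0 z j k)

/-- The contribution of iteration `k` to the bound on the gap. -/
def stepError (s : ℝ) (k : ℕ) : ℝ :=
  -- The coefficient `2` is `3 / 2`, from splitting the difference of the two directions into three
  -- squares, plus `1 / 2` from the regret of `ghost`.
  2 * γ ^ 2 * ‖levelError V γ B M x0 z j k‖ ^ 2 + 3 / 2 * γ ^ 2 * s ^ 2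
    + γ * inner ℝ (levelError V γ B M x0 z j k)
      (ghost V γ B M x0 z j k - halfIterate V γ B M x0 z j k)

variable {V γ B M x0}
variable [MeasurableSpace S] {π : Measure S} {L D σ Δ : ℝ}

theorem iterate_mem (hV : V.MonotoneSetting π L D σ Δ) (hx0 : x0 ∈ V.X) (k : ℕ) :
    (iterate V γ B M x0 z j k).1 ∈ V.X := by
  cases k with
  | zero => exact hx0
  | succ k => exact (hV.isProx_prox γ _).1

theorem halfIterate_mem (hV : V.MonotoneSetting π L D σ Δ) (k : ℕ) :
    halfIterate V γ B M x0 z j k ∈ V.X :=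
  (hV.isProx_prox γ _).1

theorem ghost_mem (hV : V.MonotoneSetting π L D σ Δ) (hx0 : x0 ∈ V.X) (k : ℕ) :
    ghost V γ B M x0 z j k ∈ V.X := by
  cases k with
  | zero => exact hx0
  | succ k => exact (hV.isProx_proj _).1

theorem averagedOutput_mem (hV : V.MonotoneSetting π L D σ Δ) {N : ℕ} (hN : 1 ≤ N) :
    averagedOutput V γ B M N x0 z j ∈ V.X := by
  have hN0 : (N : ℝ) ≠ 0 := by positivity
  rw [averagedOutput, Finset.smul_sum]
  refine hV.convex_X.sum_mem (fun _ _ => by positivity) ?_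
    fun k _ => halfIterate_mem (M := M) (x0 := x0) z j hV k
  simp [hN0]

/-- The potential inequality of one iteration. -/
theorem step_le (hV : V.MonotoneSetting π L D σ Δ) (hx0 : x0 ∈ V.X) (hB : 1 ≤ B) (hL : 0 ≤ L)
    (hγ : 0 ≤ γ) (hγL : γ * L ≤ 1 / 3) {y : Vec d} (hy : y ∈ V.X) (k : ℕ) :
    γ * (inner ℝ (V.F y) (halfIterate V γ B M x0 z j k - y)
        + V.r (halfIterate V γ B M x0 z j k) - V.r y) ≤
      (1 / 2 * ‖(iterate V γ B M x0 z j k).1 - y‖ ^ 2 + 1 / 2 * ‖ghost V γ B M x0 z j k - y‖ ^ 2)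
      - (1 / 2 * ‖(iterate V γ B M x0 z j (k + 1)).1 - y‖ ^ 2
        + 1 / 2 * ‖ghost V γ B M x0 z j (k + 1) - y‖ ^ 2)
      + stepError V γ B M x0 z j (noiseLevel D σ Δ) k := by
  have hx := iterate_mem (γ := γ) (B := B) (M := M) z j hV hx0 k
  have hp := halfIterate_mem (γ := γ) (B := B) (M := M) (x0 := x0) z j hV k
  have hPp : IsProx V.X (fun y => γ * V.r y) ((iterate V γ B M x0 z j k).1
      - γ • batchMean V z (iterate V γ B M x0 z j k).1 (iterate V γ B M x0 z j k).2 B)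
      (halfIterate V γ B M x0 z j k) := hV.isProx_prox γ _
  have hPq : IsProx V.X (fun y => γ * V.r y) ((iterate V γ B M x0 z j k).1
      - γ • multilevelEstimate V B M z (halfIterate V γ B M x0 z j k)
        ((iterate V γ B M x0 z j k).2 + B) (j k))
      (iterate V γ B M x0 z j (k + 1)).1 := hV.isProx_prox γ _
  have hPu : IsProx V.X (fun _ => 0) (ghost V γ B M x0 z j k + γ • levelError V γ B M x0 z j k)
      (ghost V γ B M x0 z j (k + 1)) := hV.isProx_proj _
  have hEG := extragradient_step hV.convex_X (hV.convexOn_mul_r hγ) hPp hPq hy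
  have hR := hPu.regret_le hV.convex_X hy
  have hb := hV.norm_batchMean_sub_le hx z (iterate V γ B M x0 z j k).2 hB
  have hF := hV.lipschitz _ hp _ hx
  have hmono := hV.monotone _ hp _ hy
  have hs := noiseLevel_nonneg D σ Δ
  have hξ : levelError V γ B M x0 z j k = multilevelEstimate V B M z (halfIterate V γ B M x0 z j k)
        ((iterate V γ B M x0 z j k).2 + B) (j k) - V.F (halfIterate V γ B M x0 z j k) := rfl
  rw [stepError]
  set g := multilevelEstimate V B M z (halfIterate V γ B M x0 z j k)
        ((iterate V γ B M x0 z j k).2 + B) (j k)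
  set b := batchMean V z (iterate V γ B M x0 z j k).1 (iterate V γ B M x0 z j k).2 B
  set x := (iterate V γ B M x0 z j k).1
  set p := halfIterate V γ B M x0 z j k
  set q := (iterate V γ B M x0 z j (k + 1)).1
  set u := ghost V γ B M x0 z j k
  set u' := ghost V γ B M x0 z j (k + 1)
  set ξ := levelError V γ B M x0 z j k
  set s := noiseLevel D σ Δ
  have hgb : ‖g - b‖ ≤ ‖ξ‖ + L * ‖p - x‖ + s := by
    have : g - b = ξ + (V.F p - V.F x) - (b - V.F x) := by rw [hξ]; abel
    rw [this]
    exact (_root_.norm_sub_le _ _).trans (add_le_add ((norm_add_le _ _).trans (by gcongr)) hb)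
  have hgb2 : ‖g - b‖ ^ 2 ≤ 3 * (‖ξ‖ ^ 2 + (L * ‖p - x‖) ^ 2 + s ^ 2) := by
    have h1 := pow_le_pow_left₀ (norm_nonneg _) hgb 2
    nlinarith [sq_nonneg (‖ξ‖ - L * ‖p - x‖), sq_nonneg (‖ξ‖ - s), sq_nonneg (L * ‖p - x‖ - s)]
  -- After the factor `3 / 2` this costs `1 / 6 * ‖p - x‖ ^ 2`, less than the `1 / 2 * ‖p - x‖ ^ 2`
  -- that the extragradient step leaves over.
  have hγL2 : γ ^ 2 * (L * ‖p - x‖) ^ 2 ≤ 1 / 9 * ‖p - x‖ ^ 2 := by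
    have h1 : (γ * L) ^ 2 ≤ (1 / 3) ^ 2 := pow_le_pow_left₀ (by positivity) hγL 2
    calc γ ^ 2 * (L * ‖p - x‖) ^ 2 = (γ * L) ^ 2 * ‖p - x‖ ^ 2 := by ring
      _ ≤ (1 / 3) ^ 2 * ‖p - x‖ ^ 2 := by gcongr
      _ = _ := by ring
  have hgb3 := mul_le_mul_of_nonneg_left hgb2 (sq_nonneg γ)
  rw [real_inner_smul_left, norm_smul, mul_pow, Real.norm_eq_abs, sq_abs] at hR
  have e1 : inner ℝ (V.F p) (p - y) = inner ℝ g (p - y) - inner ℝ ξ (p - y) := by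
    rw [← inner_sub_left, hξ]; congr 1; abel
  -- The free point `y` is separated from the error through `u`: the part with `y - u` is covered by
  -- the regret, the other part does not involve `y`.
  have e2 : inner ℝ ξ (p - y) = - inner ℝ ξ (y - u) - inner ℝ ξ (u - p) := by
    rw [← inner_neg_right, ← inner_sub_right]; congr 1; abel
  rw [inner_sub_left] at hmono
  have hm : γ * (inner ℝ (V.F y) (p - y) + V.r p - V.r y)
      ≤ γ * (inner ℝ g (p - y) + V.r p - V.r y) + γ * inner ℝ ξ (y - u)
        + γ * inner ℝ ξ (u - p) := by
    rw [← mul_add, ← mul_add]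
    refine mul_le_mul_of_nonneg_left ?_ hγ
    linarith
  nlinarith [sq_nonneg ‖p - x‖]

/-- The step inequalities telescope and Jensen handles `r`. The right side is free of `y`, so it
bounds the supremum pathwise. `D ^ 2` is the sum of the two initial potentials, each at most `D ^ 2
/ 2`. -/
theorem gap_averagedOutput_le (hV : V.MonotoneSetting π L D σ Δ) (hx0 : x0 ∈ V.X) (hB : 1 ≤ B)
    (hL : 0 ≤ L) (hγ : 0 < γ) (hγL : γ * L ≤ 1 / 3) {N : ℕ} (hN : 1 ≤ N) :
    V.gap (averagedOutput V γ B M N x0 z j) ≤ (γ * N)⁻¹ *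
      (D ^ 2 + ∑ k ∈ Finset.range N, stepError V γ B M x0 z j (noiseLevel D σ Δ) k) := by
  have : Nonempty V.X := hV.nonempty_X.to_subtype
  have hN0 : (0 : ℝ) < N := by positivity
  refine ciSup_le fun ⟨y, hy⟩ => ?_
  rw [le_inv_mul_iff₀ (by positivity)]
  have hsum : ∀ n, ∑ k ∈ Finset.range n, γ * (inner ℝ (V.F y) (halfIterate V γ B M x0 z j k - y)
        + V.r (halfIterate V γ B M x0 z j k) - V.r y) ≤
      (1 / 2 * ‖x0 - y‖ ^ 2 + 1 / 2 * ‖x0 - y‖ ^ 2)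
      - (1 / 2 * ‖(iterate V γ B M x0 z j n).1 - y‖ ^ 2 + 1 / 2 * ‖ghost V γ B M x0 z j n - y‖ ^ 2)
      + ∑ k ∈ Finset.range n, stepError V γ B M x0 z j (noiseLevel D σ Δ) k := by
    intro n
    induction n with
    | zero => simp [iterate, ghost]
    | succ n ih =>
      rw [Finset.sum_range_succ, Finset.sum_range_succ]
      have := step_le (M := M) z j hV hx0 hB hL hγ.le hγL hy n
      linarith
  have hr : V.r (averagedOutput V γ B M N x0 z j)
      ≤ (N : ℝ)⁻¹ * ∑ k ∈ Finset.range N, V.r (halfIterate V γ B M x0 z j k) := by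
    rw [averagedOutput, Finset.smul_sum, Finset.mul_sum]
    exact hV.convex_r.map_sum_le (fun _ _ => by positivity) (by simp [hN0.ne'])
      fun _ _ => Set.mem_univ _
  have hr' := mul_le_mul_of_nonneg_left hr hN0.le
  rw [mul_inv_cancel_left₀ hN0.ne'] at hr'
  have hi : (N : ℝ) * inner ℝ (V.F y) (averagedOutput V γ B M N x0 z j - y)
      = ∑ k ∈ Finset.range N, inner ℝ (V.F y) (halfIterate V γ B M x0 z j k - y) := by
    rw [← inner_sum, ← real_inner_smul_right, Finset.sum_sub_distrib, smul_sub, averagedOutput,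
      smul_smul, mul_inv_cancel₀ hN0.ne', one_smul, Finset.sum_const, Finset.card_range,
      Nat.cast_smul_eq_nsmul ℝ]
    rfl
  have h1 := hsum N
  rw [← Finset.mul_sum, Finset.sum_sub_distrib, Finset.sum_add_distrib, ← hi, Finset.sum_const,
    Finset.card_range, nsmul_eq_mul] at h1
  have h2 := mul_le_mul_of_nonneg_left hr' hγ.le
  have h3 := hV.diam_X x0 hx0 y hy
  have h4 : 0 ≤ ‖(iterate V γ B M x0 z j N).1 - y‖ ^ 2 := by positivity
  have h5 : 0 ≤ ‖ghost V γ B M x0 z j N - y‖ ^ 2 := by positivity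
  nlinarith

end Path

end Setting

/-! ### Sums of mixing rates -/

section GeometricSums

/-- The exponent is constant on blocks of length `τ`, so this is `τ` times a geometric sum. Keeping
the factor `1 - (1 / 4) ^ q` closes the induction. -/
theorem sum_range_mul_quarter_pow_le {τ : ℕ} (hτ : 1 ≤ τ) (q : ℕ) :
    ∑ m ∈ Finset.range (τ * q), (1 / 4 : ℝ) ^ (m / τ) ≤ 4 / 3 * τ * (1 - (1 / 4) ^ q) := by
  induction q with
  | zero => simp
  | succ q ih =>
    rw [Nat.mul_succ, Finset.sum_range_add]
    have : ∑ x ∈ Finset.range τ, (1 / 4 : ℝ) ^ ((τ * q + x) / τ) = τ * (1 / 4) ^ q := by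
      rw [Finset.sum_congr rfl (g := fun _ => (1 / 4 : ℝ) ^ q), Finset.sum_const,
        Finset.card_range, nsmul_eq_mul]
      intro x hx
      rw [Nat.mul_add_div hτ, Nat.div_eq_of_lt (Finset.mem_range.1 hx), add_zero]
    rw [this, pow_succ]
    nlinarith

theorem sum_range_quarter_pow_le {τ : ℕ} (hτ : 1 ≤ τ) (n : ℕ) :
    ∑ m ∈ Finset.range n, (1 / 4 : ℝ) ^ (m / τ) ≤ 4 / 3 * τ := by
  have h1 : ∑ m ∈ Finset.range n, (1 / 4 : ℝ) ^ (m / τ)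
      ≤ ∑ m ∈ Finset.range (τ * n), (1 / 4 : ℝ) ^ (m / τ) :=
    Finset.sum_le_sum_of_subset_of_nonneg
      (Finset.range_mono (Nat.le_mul_of_pos_left n hτ)) fun _ _ _ => by positivity
  refine h1.trans ((sum_range_mul_quarter_pow_le hτ n).trans ?_)
  have : (0 : ℝ) ≤ (1 / 4) ^ n := by positivity
  have : (0 : ℝ) ≤ τ := by positivity
  nlinarith

theorem sum_quarter_pow_comp_le {τ : ℕ} (hτ : 1 ≤ τ) (s : Finset ℕ) (e : ℕ → ℕ)
    (he : Set.InjOn e s) : ∑ i ∈ s, (1 / 4 : ℝ) ^ (e i / τ) ≤ 4 / 3 * τ := by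
  rw [← Finset.sum_image (f := fun m => (1 / 4 : ℝ) ^ (m / τ)) he]
  refine (Finset.sum_le_sum_of_subset_of_nonneg (t := Finset.range ((s.image e).sup id + 1))
    (fun m hm => ?_) fun _ _ _ => by positivity).trans (sum_range_quarter_pow_le hτ _)
  rw [Finset.mem_range, Nat.lt_succ_iff]
  exact Finset.le_sup (f := id) hm

/-- Distances are distinct on each side of `i`, so each side contributes at most `4 / 3 * τ`. -/
theorem sum_quarter_pow_dist_le {τ : ℕ} (hτ : 1 ≤ τ) (s : Finset ℕ) (i : ℕ) :
    ∑ l ∈ s, (1 / 4 : ℝ) ^ (Nat.dist i l / τ) ≤ 8 / 3 * τ := by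
  rw [← Finset.sum_filter_add_sum_filter_not s (fun l => l ≤ i)]
  have h1 := sum_quarter_pow_comp_le hτ (s.filter fun l => l ≤ i) (Nat.dist i) (by
    intro a ha b hb hab
    simp only [Finset.coe_filter, Set.mem_ofPred_eq] at ha hb
    simp only [Nat.dist] at hab
    omega)
  have h2 := sum_quarter_pow_comp_le hτ (s.filter fun l => ¬ l ≤ i) (Nat.dist i) (by
    intro a ha b hb hab
    simp only [Finset.coe_filter, Set.mem_ofPred_eq] at ha hb
    simp only [Nat.dist] at hab
    omega)
  linarith

end GeometricSums

/-! ### Bias and variance of batch means -/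

section BatchMoments

variable {d : ℕ} {S : Type*} [MeasurableSpace S] {V : VIData d S} {π : Measure S} {L D σ Δ : ℝ}

/-- The Lipschitz bound holds only on `V.X`; measurability on the whole space comes from `F` being
the `π`-average of the oracle. -/
theorem VIData.MonotoneSetting.measurable_F [SFinite π] (hV : V.MonotoneSetting π L D σ Δ) :
    Measurable V.F := by
  have h : V.F = fun x => ∫ z, V.oracle x z ∂π := funext fun x => (hV.unbiased x).symm
  rw [h]
  exact (hV.measurable_oracle.stronglyMeasurable.integral_prod_right (ν := π)).measurable

theorem VIData.MonotoneSetting.integral_inner_eq_zero [IsProbabilityMeasure π]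
    (hV : V.MonotoneSetting π L D σ Δ) (x w : Vec d) :
    ∫ z, inner ℝ (V.oracle x z - V.F x) w ∂π = 0 := by
  simp_rw [real_inner_comm w]
  rw [integral_inner (f := fun z => V.oracle x z - V.F x)
      ((hV.integrable_oracle x).sub (integrable_const _)),
    integral_sub (hV.integrable_oracle x) (integrable_const _), hV.unbiased]
  simp

theorem measurable_oracle_sub [SFinite π] {Ω : Type*} {m : MeasurableSpace Ω}
    (hV : V.MonotoneSetting π L D σ Δ) {x : Ω → Vec d} {y : Ω → S}
    (hx : Measurable[m] x) (hy : Measurable[m] y) :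
    Measurable[m] fun ω => V.oracle (x ω) (y ω) - V.F (x ω) :=
  Measurable.sub (hV.measurable_oracle.comp (Measurable.prodMk hx hy)) (hV.measurable_F.comp hx)

variable {Ω : Type*} [MeasurableSpace Ω] {Q : Kernel S S} [IsMarkovKernel Q] {P : Measure Ω}
  [IsProbabilityMeasure P] {Z : ℕ → Ω → S} {τ : ℕ}

/-- The noise of the oracle `k` steps ahead, at a point that depends on the past, is nearly
uncorrelated with every bounded vector that depends on the past. -/
theorem abs_integral_inner_oracle_le (hV : V.MonotoneSetting π L D σ Δ)
    (hQ : UniformlyErgodic Q π τ) (hZ : IsMarkovChain Q P Z) {n : ℕ} {x w : Ω → Vec d}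
    (hx : Measurable[past Z n] x) (hxX : ∀ ω, x ω ∈ V.X) (hw : Measurable[past Z n] w) {K : ℝ}
    (hK : ∀ ω, ‖w ω‖ ≤ K) (k : ℕ) :
    |∫ ω, inner ℝ (V.oracle (x ω) (Z (n + k) ω) - V.F (x ω)) (w ω) ∂P|
      ≤ 2 * (noiseLevel D σ Δ * K) * (1 / 4) ^ (k / τ) := by
  have := hQ.isProbabilityMeasure
  have hwK : ∀ ω, w ω ∈ Metric.closedBall (0 : Vec d) K := fun ω => by simpa using hK ω
  have hm := hV.measurable_oracle
  have hF := hV.measurable_F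
  -- The past variable takes values in a subtype because the bound on `f` must hold for every value
  -- of it, not only for those attained.
  refine hZ.abs_integral_le hQ (H := V.X × Metric.closedBall (0 : Vec d) K)
    (h := fun ω => (⟨x ω, hxX ω⟩, ⟨w ω, hwK ω⟩))
    (f := fun a y => inner ℝ (V.oracle a.1 y - V.F a.1) (a.2 : Vec d))
    (Measurable.prodMk (Measurable.subtype_mk hx) (Measurable.subtype_mk hw)) ?_ ?_ ?_ k
  · have h1 : Measurable fun p : (V.X × Metric.closedBall (0 : Vec d) K) × S =>
        V.oracle p.1.1 p.2 :=
      hm.comp ((measurable_subtype_coe.comp (measurable_fst.comp measurable_fst)).prodMk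
        measurable_snd)
    have h2 : Measurable fun p : (V.X × Metric.closedBall (0 : Vec d) K) × S => V.F p.1.1 :=
      hF.comp (measurable_subtype_coe.comp (measurable_fst.comp measurable_fst))
    have h3 : Measurable fun p : (V.X × Metric.closedBall (0 : Vec d) K) × S =>
        (p.1.2 : Vec d) :=
      measurable_subtype_coe.comp (measurable_snd.comp measurable_fst)
    exact (h1.sub h2).inner h3
  · rintro ⟨⟨a, ha⟩, ⟨v, hv⟩⟩ y
    refine (abs_real_inner_le_norm _ _).trans
      (mul_le_mul (hV.norm_oracle_sub_le ha y) (by simpa using hv) (norm_nonneg _)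
        (noiseLevel_nonneg _ _ _))
  · rintro ⟨⟨a, ha⟩, ⟨v, hv⟩⟩
    exact hV.integral_inner_eq_zero a v

/-- The correlations of the `n` samples with the past are summable with total of order `τ`, so
averaging leaves `τ / n`. -/
theorem abs_integral_inner_batchMean_le (hV : V.MonotoneSetting π L D σ Δ)
    (hQ : UniformlyErgodic Q π τ) (hZ : IsMarkovChain Q P Z) {T n : ℕ} (hn : 1 ≤ n)
    {x w : Ω → Vec d} (hx : Measurable[past Z T] x) (hxX : ∀ ω, x ω ∈ V.X)
    (hw : Measurable[past Z T] w) {K : ℝ} (hK0 : 0 ≤ K) (hK : ∀ ω, ‖w ω‖ ≤ K) :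
    |∫ ω, inner ℝ (batchMean V (fun i => Z i ω) (x ω) T n - V.F (x ω)) (w ω) ∂P|
      ≤ 8 / 3 * (noiseLevel D σ Δ * K) * (τ / n) := by
  have := hQ.isProbabilityMeasure
  have hn0 : (0 : ℝ) < n := by positivity
  have hs := noiseLevel_nonneg D σ Δ
  simp_rw [batchMean_sub V _ _ _ hn, real_inner_smul_left, sum_inner]
  rw [integral_const_mul, integral_finsetSum]
  · rw [abs_mul, abs_inv, abs_of_pos hn0, inv_mul_le_iff₀ hn0]
    refine (Finset.abs_sum_le_sum_abs _ _).trans ((Finset.sum_le_sum fun i _ =>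
      abs_integral_inner_oracle_le hV hQ hZ hx hxX hw hK i).trans ?_)
    rw [← Finset.mul_sum]
    have h1 := mul_le_mul_of_nonneg_left
      (sum_quarter_pow_comp_le hQ.one_le (Finset.Icc 1 n) id (fun _ _ _ _ h => h))
      (show 0 ≤ 2 * (noiseLevel D σ Δ * K) by positivity)
    refine h1.trans (le_of_eq ?_)
    field_simp
    ring
  · intro i _
    refine Integrable.of_bound (C := noiseLevel D σ Δ * K) ?_ (ae_of_all _ fun ω => ?_)
    · exact ((measurable_oracle_sub hV (hx.mono (hZ.past_le T) le_rfl) (hZ.measurable _)).inner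
        (hw.mono (hZ.past_le T) le_rfl)).aestronglyMeasurable
    · exact (norm_inner_le_norm _ _).trans
        (mul_le_mul (hV.norm_oracle_sub_le (hxX ω) _) (hK ω) (norm_nonneg _) hs)

/-- In the expanded square the covariances decay with the distance of the indices, so each of the
`n` rows sums to order `τ`. The constant `6` rounds up `2 * (8 / 3)`. -/
theorem integral_norm_sq_batchMean_le (hV : V.MonotoneSetting π L D σ Δ)
    (hQ : UniformlyErgodic Q π τ) (hZ : IsMarkovChain Q P Z) {T n : ℕ} (hn : 1 ≤ n)
    {x : Ω → Vec d} (hx : Measurable[past Z T] x) (hxX : ∀ ω, x ω ∈ V.X) :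
    ∫ ω, ‖batchMean V (fun i => Z i ω) (x ω) T n - V.F (x ω)‖ ^ 2 ∂P
      ≤ 6 * noiseLevel D σ Δ ^ 2 * (τ / n) := by
  have := hQ.isProbabilityMeasure
  have hn0 : (0 : ℝ) < n := by positivity
  set s := noiseLevel D σ Δ with hsdef
  have hs : 0 ≤ s := noiseLevel_nonneg D σ Δ
  set e : ℕ → Ω → Vec d := fun i ω => V.oracle (x ω) (Z (T + i) ω) - V.F (x ω) with he
  have hem : ∀ i, Measurable[past Z (T + i)] (e i) := fun i =>
    measurable_oracle_sub hV (hx.mono (past_mono Z (Nat.le_add_right T i)) le_rfl)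
      (measurable_past Z le_rfl)
  have hes : ∀ i ω, ‖e i ω‖ ≤ s := fun i ω => hV.norm_oracle_sub_le (hxX ω) _
  have hint : ∀ i l, Integrable (fun ω => inner ℝ (e i ω) (e l ω)) P := fun i l =>
    Integrable.of_bound (C := s * s)
      (((hem i).mono (hZ.past_le _) le_rfl).inner
        ((hem l).mono (hZ.past_le _) le_rfl)).aestronglyMeasurable
      (ae_of_all _ fun ω => (norm_inner_le_norm _ _).trans
        (mul_le_mul (hes i ω) (hes l ω) (norm_nonneg _) hs))
  have hcov' : ∀ i l, i ≤ l → |∫ ω, inner ℝ (e l ω) (e i ω) ∂P|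
      ≤ 2 * (s * s) * (1 / 4) ^ ((l - i) / τ) := by
    intro i l hil
    -- The earlier error `e i` plays the role of the bounded vector known at time `T + i`.
    have h1 := abs_integral_inner_oracle_le hV hQ hZ (n := T + i)
      (hx.mono (past_mono Z (Nat.le_add_right T i)) le_rfl) hxX (hem i) (hes i) (l - i)
    have : T + i + (l - i) = T + l := by omega
    rwa [this] at h1
  have hcov : ∀ i l, ∫ ω, inner ℝ (e i ω) (e l ω) ∂P
      ≤ 2 * (s * s) * (1 / 4) ^ (Nat.dist i l / τ) := by
    intro i l
    rcases le_total i l with h | h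
    · rw [Nat.dist_eq_sub_of_le h]
      simp_rw [real_inner_comm (e l _)]
      exact (le_abs_self _).trans (hcov' i l h)
    · rw [Nat.dist_eq_sub_of_le_right h]
      exact (le_abs_self _).trans (hcov' l i h)
  have hexp : ∀ ω, ‖batchMean V (fun i => Z i ω) (x ω) T n - V.F (x ω)‖ ^ 2
      = ((n : ℝ)⁻¹) ^ 2 * ∑ i ∈ Finset.Icc 1 n, ∑ l ∈ Finset.Icc 1 n, inner ℝ (e i ω) (e l ω) := by
    intro ω
    rw [batchMean_sub V _ _ _ hn, norm_smul, mul_pow, Real.norm_of_nonneg (by positivity),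
      ← real_inner_self_eq_norm_sq, sum_inner]
    simp_rw [inner_sum]
    rfl
  simp_rw [hexp]
  rw [integral_const_mul,
    integral_finsetSum _ fun i _ => integrable_finsetSum _ fun l _ => hint i l]
  have hrow : ∀ i ∈ Finset.Icc 1 n,
      ∫ ω, ∑ l ∈ Finset.Icc 1 n, inner ℝ (e i ω) (e l ω) ∂P ≤ 6 * s ^ 2 * τ := by
    intro i _
    rw [integral_finsetSum _ fun l _ => hint i l]
    refine (Finset.sum_le_sum fun l _ => hcov i l).trans ?_
    rw [← Finset.mul_sum]
    have h1 := mul_le_mul_of_nonneg_left (sum_quarter_pow_dist_le hQ.one_le (Finset.Icc 1 n) i)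
      (show 0 ≤ 2 * (s * s) by positivity)
    have : 0 ≤ s ^ 2 * τ := by positivity
    nlinarith
  calc _ ≤ ((n : ℝ)⁻¹) ^ 2 * ∑ i ∈ Finset.Icc 1 n, 6 * s ^ 2 * τ := by
        gcongr with i hi; exact hrow i hi
    _ = _ := by
        rw [Finset.sum_const, Nat.card_Icc, Nat.add_sub_cancel, nsmul_eq_mul]
        field_simp

end BatchMoments

/-! ### Independence of the random levels -/

section Sampling

variable {S Ω : Type*} [MeasurableSpace S] [MeasurableSpace Ω] {P : Measure Ω}
  {Z : ℕ → Ω → S} {J : ℕ → Ω → ℕ}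

theorem IsGeometricSampling.measureReal_eq (hJ : IsGeometricSampling P J Z) (k : ℕ) {l : ℕ}
    (hl : 1 ≤ l) : P.real {ω | J k ω = l} = (1 / 2) ^ l := by
  rw [Measure.real, hJ.law k l hl, ENNReal.toReal_pow]
  norm_num

/-- The level `J k` is independent of the previous ones. -/
theorem IsGeometricSampling.integral_ite_eq (hJ : IsGeometricSampling P J Z) (k : ℕ) {l : ℕ}
    (hl : 1 ≤ l) {a : (ℕ → ℕ) → ℝ} (ha : ∀ j j', (∀ i < k, j i = j' i) → a j = a j') :
    ∫ ω, (if J k ω = l then a (fun i => J i ω) else 0) ∂P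
      = (1 / 2) ^ l * ∫ ω, a (fun i => J i ω) ∂P := by
  have hind := hJ.iIndep.indepFun_finset {k} (Finset.range k) (by simp) hJ.measurable
  let f : (({k} : Finset ℕ) → ℕ) → ℝ := fun b => if b ⟨k, by simp⟩ = l then 1 else 0
  let g : (Finset.range k → ℕ) → ℝ := fun b =>
    a fun i => if h : i < k then b ⟨i, Finset.mem_range.2 h⟩ else 0
  have hfg := hind.comp (φ := f) (ψ := g) (measurable_of_countable _) (measurable_of_countable _)
  have hg : ∀ ω, (g ∘ fun ω (i : Finset.range k) => J i ω) ω = a fun i => J i ω := fun ω =>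
    ha _ _ fun i hi => by simp [hi]
  have hf : ∀ ω, (f ∘ fun ω (i : ({k} : Finset ℕ)) => J i ω) ω
      = Set.indicator {ω | J k ω = l} (fun _ => (1 : ℝ)) ω := fun ω => by
    by_cases h : J k ω = l <;> simp [f, h]
  have hS : MeasurableSet {ω | J k ω = l} := hJ.measurable k (measurableSet_singleton l)
  have h := hfg.integral_fun_mul_eq_mul_integral
    ((measurable_of_countable f).comp
      (measurable_pi_lambda _ fun i => hJ.measurable i)).aestronglyMeasurable
    ((measurable_of_countable g).comp
      (measurable_pi_lambda _ fun i => hJ.measurable i)).aestronglyMeasurable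
  simp_rw [hg, hf] at h
  rw [integral_indicator_const _ hS, hJ.measureReal_eq k hl, smul_eq_mul, mul_one] at h
  rw [← h]
  refine integral_congr_ae (ae_of_all _ fun ω => ?_)
  by_cases h : J k ω = l <;> simp [h]

variable [IsProbabilityMeasure P]

/-- The sequence that continues a finite one by zeros. -/
def padZero {N : ℕ} (a : Fin N → ℕ) (i : ℕ) : ℕ := if h : i < N then a ⟨i, h⟩ else 0

/-- The levels and the chain may be averaged one after the other. -/
theorem IsGeometricSampling.integral_eq (hJ : IsGeometricSampling P J Z)
    (hZ : ∀ n, Measurable (Z n)) (N : ℕ) {G : (ℕ → ℕ) → (ℕ → S) → ℝ}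
    (hG : ∀ j j', (∀ i < N, j i = j' i) → G j = G j') (hm : ∀ j, Measurable (G j)) {K : ℝ}
    (hK : ∀ j z, |G j z| ≤ K) :
    Integrable (fun ω => G (fun k => J k ω) (fun n => Z n ω)) P ∧
    Integrable (fun ω' => ∫ ω, G (fun k => J k ω') (fun n => Z n ω) ∂P) P ∧
    ∫ ω, G (fun k => J k ω) (fun n => Z n ω) ∂P
      = ∫ ω', ∫ ω, G (fun k => J k ω') (fun n => Z n ω) ∂P ∂P := by
  set A : Ω → Fin N → ℕ := fun ω i => J i ω
  set Y : Ω → ℕ → S := fun ω n => Z n ω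
  have hA : Measurable A := measurable_pi_lambda _ fun i => hJ.measurable i
  have hY : Measurable Y := measurable_pi_lambda _ hZ
  have hAY : IndepFun A Y P := hJ.indep.comp (φ := fun (j : ℕ → ℕ) (i : Fin N) => j i) (ψ := id)
    (measurable_pi_lambda _ fun i => measurable_pi_apply _) measurable_id
  have hGA : ∀ ω, G (fun k => J k ω) = G (padZero (A ω)) := fun ω =>
    hG _ _ fun i hi => by simp [padZero, hi, A]
  -- Finitely many levels take countably many values, so measurability in the path for each fixed
  -- choice already gives joint measurability.
  have hGm : Measurable fun p : (Fin N → ℕ) × (ℕ → S) => G (padZero p.1) p.2 :=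
    measurable_from_prod_countable_right fun a => hm (padZero a)
  have hcm : StronglyMeasurable fun a : Fin N → ℕ => ∫ ω, G (padZero a) (Y ω) ∂P :=
    (measurable_of_countable _).stronglyMeasurable
  simp_rw [hGA]
  refine ⟨?_, ?_, ?_⟩
  · exact Integrable.of_bound (C := K) (hGm.comp (hA.prodMk hY)).aestronglyMeasurable
      (ae_of_all _ fun ω => hK _ _)
  · refine Integrable.of_bound (C := K) (hcm.comp_measurable hA).aestronglyMeasurable
      (ae_of_all _ fun ω' => ?_)
    simpa using norm_integral_le_of_norm_le_const (μ := P) (f := fun ω => G (padZero (A ω')) (Y ω))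
      (ae_of_all _ fun ω => hK _ _)
  · have hprod := (indepFun_iff_map_prod_eq_prod_map_map hA.aemeasurable hY.aemeasurable).1 hAY
    have : IsProbabilityMeasure (P.map A) := Measure.isProbabilityMeasure_map hA.aemeasurable
    have : IsProbabilityMeasure (P.map Y) := Measure.isProbabilityMeasure_map hY.aemeasurable
    have e1 : ∫ ω, G (padZero (A ω)) (Y ω) ∂P
        = ∫ p, G (padZero p.1) p.2 ∂(P.map fun ω => (A ω, Y ω)) := by
      rw [integral_map (hA.prodMk hY).aemeasurable hGm.aestronglyMeasurable]
    rw [e1, hprod, integral_prod _ (Integrable.of_bound hGm.aestronglyMeasurable K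
      (ae_of_all _ fun p => hK _ _))]
    have e2 : ∀ a : Fin N → ℕ, ∫ y, G (padZero a) y ∂(P.map Y) = ∫ ω, G (padZero a) (Y ω) ∂P := fun a =>
      integral_map hY.aemeasurable (hm _).aestronglyMeasurable
    simp_rw [e2]
    exact integral_map hA.aemeasurable hcm.aestronglyMeasurable

/-- Averaging over the chain first leaves a function of the earlier levels, to which
`integral_ite_eq` applies. This is how the probability `2^{-l}` enters the telescoping. -/
theorem IsGeometricSampling.integral_ite_level (hJ : IsGeometricSampling P J Z)
    (hZ : ∀ n, Measurable (Z n)) (k : ℕ) {l : ℕ} (hl : 1 ≤ l) {G : (ℕ → ℕ) → (ℕ → S) → ℝ}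
    (hG : ∀ j j', (∀ i < k, j i = j' i) → G j = G j') (hm : ∀ j, Measurable (G j)) {K : ℝ}
    (hK : ∀ j z, |G j z| ≤ K) :
    Integrable (fun ω => if J k ω = l then G (fun i => J i ω) (fun n => Z n ω) else 0) P ∧
    ∫ ω, (if J k ω = l then G (fun i => J i ω) (fun n => Z n ω) else 0) ∂P
      = (1 / 2) ^ l * ∫ ω, G (fun i => J i ω) (fun n => Z n ω) ∂P := by
  have h1 := hJ.integral_eq hZ (k + 1) (G := fun j z => if j k = l then G j z else 0) (K := K)
    (fun j j' h => by
      rw [hG j j' fun i hi => h i (by omega), h k (by omega)])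
    (fun j => by
      by_cases hj : j k = l
      · simpa [hj] using hm j
      · simp [hj])
    (fun j z => by
      by_cases hj : j k = l
      · simpa [hj] using hK j z
      · simpa [hj] using (abs_nonneg _).trans (hK j z))
  refine ⟨h1.1, ?_⟩
  rw [h1.2.2, (hJ.integral_eq hZ k hG hm hK).2.2,
    ← hJ.integral_ite_eq k hl (a := fun j => ∫ ω, G j (fun n => Z n ω) ∂P)
      (fun j j' h => by simp only [hG j j' h])]
  refine integral_congr_ae (ae_of_all _ fun ω' => ?_)
  by_cases h : J k ω' = l <;> simp [h]

/-- The truncated level size has logarithmic mean. -/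
theorem IsGeometricSampling.integral_two_pow_le (hJ : IsGeometricSampling P J Z) (k : ℕ) {M : ℝ}
    {m : ℕ} (hM : ∀ l : ℕ, (2 : ℝ) ^ l ≤ M ↔ l ≤ m) :
    Integrable (fun ω => if (2 : ℝ) ^ J k ω ≤ M then (2 : ℝ) ^ J k ω else 0) P ∧
    ∫ ω, (if (2 : ℝ) ^ J k ω ≤ M then (2 : ℝ) ^ J k ω else 0) ∂P ≤ 1 + m := by
  have hS : ∀ l, MeasurableSet {ω | J k ω = l} := fun l =>
    hJ.measurable k (measurableSet_singleton l)
  have e : (fun ω => if (2 : ℝ) ^ J k ω ≤ M then (2 : ℝ) ^ J k ω else 0)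
      = fun ω => ∑ l ∈ Finset.range (m + 1), {ω | J k ω = l}.indicator (fun _ => (2 : ℝ) ^ l) ω := by
    ext ω
    simp [hM, Set.indicator_apply, Finset.sum_ite_eq]
  have hi : ∀ l ∈ Finset.range (m + 1),
      Integrable ({ω | J k ω = l}.indicator fun _ => (2 : ℝ) ^ l) P := fun l _ =>
    (integrable_const _).indicator (hS l)
  rw [e]
  refine ⟨integrable_finsetSum _ hi, ?_⟩
  rw [integral_finsetSum _ hi, Finset.sum_range_succ']
  simp_rw [integral_indicator_const _ (hS _)]
  -- The crude bound on level `0` gives the `1` in `1 + m`; each level from `1` to `m` contributes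
  -- exactly `1`.
  have h0 : P.real {ω | J k ω = 0} ≤ 1 := measureReal_le_one
  have h1 : ∀ l ∈ Finset.range m, P.real {ω | J k ω = l + 1} • (2 : ℝ) ^ (l + 1) = 1 := by
    intro l _
    rw [hJ.measureReal_eq k (by omega), smul_eq_mul, ← mul_pow]
    norm_num
  rw [Finset.sum_congr rfl h1]
  simp
  linarith

end Sampling

/-! ### Adaptedness of the iterates for frozen levels -/

section Adapted

variable {d : ℕ} {S : Type*}

/-- The time `T^k` of the chain at the start of iteration `k`. -/
def clock (B : ℕ) (j : ℕ → ℕ) : ℕ → ℕ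
  | 0 => 0
  | k + 1 => clock B j k + B + 2 ^ j k * B

theorem clock_congr (B : ℕ) {j j' : ℕ → ℕ} {k : ℕ} (h : ∀ i < k, j i = j' i) :
    clock B j k = clock B j' k := by
  induction k with
  | zero => rfl
  | succ k ih => rw [clock, clock, ih fun i hi => h i (by omega), h k (by omega)]

variable {V : VIData d S} {γ : ℝ} {B : ℕ} {M : ℝ} {x0 : Vec d}

/-- The clock does not depend on the noise: for frozen levels all sampling times are deterministic,
and no stopping times are needed. -/
theorem iterate_snd (z : ℕ → S) (j : ℕ → ℕ) (k : ℕ) :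
    (iterate V γ B M x0 z j k).2 = clock B j k := by
  induction k with
  | zero => rfl
  | succ k ih => rw [clock, ← ih]; rfl

theorem iterate_congr (z : ℕ → S) {j j' : ℕ → ℕ} {k : ℕ} (h : ∀ i < k, j i = j' i) :
    iterate V γ B M x0 z j k = iterate V γ B M x0 z j' k := by
  induction k with
  | zero => rfl
  | succ k ih => simp only [iterate, ih fun i hi => h i (by omega), h k (by omega)]

theorem halfIterate_congr (z : ℕ → S) {j j' : ℕ → ℕ} {k : ℕ} (h : ∀ i < k, j i = j' i) :
    halfIterate V γ B M x0 z j k = halfIterate V γ B M x0 z j' k := by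
  rw [halfIterate, halfIterate, iterate_congr z h]

theorem levelError_congr (z : ℕ → S) {j j' : ℕ → ℕ} {k : ℕ} (h : ∀ i < k + 1, j i = j' i) :
    levelError V γ B M x0 z j k = levelError V γ B M x0 z j' k := by
  have h' : ∀ i < k, j i = j' i := fun i hi => h i (by omega)
  rw [levelError, levelError, iterate_congr z h', halfIterate_congr z h', h k (by omega)]

theorem ghost_congr (z : ℕ → S) {j j' : ℕ → ℕ} {k : ℕ} (h : ∀ i < k, j i = j' i) :
    ghost V γ B M x0 z j k = ghost V γ B M x0 z j' k := by
  induction k with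
  | zero => rfl
  | succ k ih => rw [ghost, ghost, ih fun i hi => h i (by omega), levelError_congr z h]

theorem averagedOutput_congr (z : ℕ → S) {j j' : ℕ → ℕ} {N : ℕ} (h : ∀ i < N, j i = j' i) :
    averagedOutput V γ B M N x0 z j = averagedOutput V γ B M N x0 z j' := by
  rw [averagedOutput, averagedOutput]
  congr 1
  refine Finset.sum_congr rfl fun k hk => ?_
  rw [iterate_congr z fun i hi => h i (hi.trans (Finset.mem_range.1 hk))]

variable [MeasurableSpace S] {π : Measure S} {L D σ Δ : ℝ} {Ω : Type*} {Z : ℕ → Ω → S}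

theorem measurable_batchMean (hV : V.MonotoneSetting π L D σ Δ) {T n t : ℕ} {x : Ω → Vec d}
    (hx : Measurable[past Z t] x) (ht : T + n ≤ t) :
    Measurable[past Z t] fun ω => batchMean V (fun i => Z i ω) (x ω) T n := by
  unfold batchMean
  refine (measurable_const_smul (n : ℝ)⁻¹).comp (Finset.measurable_fun_sum _ fun i hi => ?_)
  have : T + i ≤ t := by have := (Finset.mem_Icc.1 hi).2; omega
  exact hV.measurable_oracle.comp (Measurable.prodMk hx (measurable_past Z this))

theorem measurable_multilevelEstimate (hV : V.MonotoneSetting π L D σ Δ) {T l t : ℕ}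
    {x : Ω → Vec d} (hx : Measurable[past Z t] x) (ht : T + 2 ^ l * B ≤ t) :
    Measurable[past Z t] fun ω => multilevelEstimate V B M (fun i => Z i ω) (x ω) T l := by
  have h1 : B ≤ 2 ^ l * B := Nat.le_mul_of_pos_left B (by positivity)
  have h2 : 2 ^ (l - 1) * B ≤ 2 ^ l * B :=
    Nat.mul_le_mul_right B (Nat.pow_le_pow_right (by norm_num) (Nat.sub_le l 1))
  have m0 := measurable_batchMean hV hx (T := T) (n := B) (by omega)
  have m1 := measurable_batchMean hV hx (T := T) (n := 2 ^ l * B) (by omega)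
  have m2 := measurable_batchMean hV hx (T := T) (n := 2 ^ (l - 1) * B) (by omega)
  unfold multilevelEstimate
  refine Measurable.add m0 ?_
  split_ifs
  · exact (measurable_const_smul ((2 : ℝ) ^ l)).comp (Measurable.sub m1 m2)
  · exact measurable_const

theorem measurable_halfIterate_of (hV : V.MonotoneSetting π L D σ Δ) (hγ : 0 ≤ γ) (j : ℕ → ℕ)
    (k : ℕ) (h : Measurable[past Z (clock B j k)]
      fun ω => (iterate V γ B M x0 (fun i => Z i ω) j k).1) :
    Measurable[past Z (clock B j k + B)]
      fun ω => halfIterate V γ B M x0 (fun i => Z i ω) j k := by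
  have h' := h.mono (past_mono Z (Nat.le_add_right _ B)) le_rfl
  simp only [halfIterate, halfStep, iterate_snd]
  exact (hV.measurable_prox hγ).comp
    (Measurable.sub h' ((measurable_const_smul γ).comp (measurable_batchMean hV h' le_rfl)))

theorem measurable_iterate (hV : V.MonotoneSetting π L D σ Δ) (hγ : 0 ≤ γ) (j : ℕ → ℕ) (k : ℕ) :
    Measurable[past Z (clock B j k)] fun ω => (iterate V γ B M x0 (fun i => Z i ω) j k).1 := by
  induction k with
  | zero => exact measurable_const
  | succ k ih =>
    have hh := (measurable_halfIterate_of hV hγ j k ih).mono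
      (past_mono Z (Nat.le_add_right _ (2 ^ j k * B))) le_rfl
    have hi := ih.mono (past_mono Z (show clock B j k ≤ clock B j (k + 1) by
      rw [clock]; omega)) le_rfl
    have hg := measurable_multilevelEstimate (B := B) (M := M) hV
      (T := clock B j k + B) (l := j k) hh le_rfl
    simp only [halfIterate, iterate_snd] at hg
    simp only [iterate, iterate_snd]
    exact (hV.measurable_prox hγ).comp (Measurable.sub hi ((measurable_const_smul γ).comp hg))

theorem measurable_halfIterate (hV : V.MonotoneSetting π L D σ Δ) (hγ : 0 ≤ γ) (j : ℕ → ℕ)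
    (k : ℕ) : Measurable[past Z (clock B j k + B)]
      fun ω => halfIterate V γ B M x0 (fun i => Z i ω) j k :=
  measurable_halfIterate_of hV hγ j k (measurable_iterate hV hγ j k)

theorem measurable_levelError [SFinite π] (hV : V.MonotoneSetting π L D σ Δ) (hγ : 0 ≤ γ)
    (j : ℕ → ℕ) (k : ℕ) : Measurable[past Z (clock B j (k + 1))]
      fun ω => levelError V γ B M x0 (fun i => Z i ω) j k := by
  have hh := (measurable_halfIterate (B := B) (M := M) (x0 := x0) hV hγ j k).mono
    (past_mono Z (Nat.le_add_right _ (2 ^ j k * B))) le_rfl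
  simp only [levelError, iterate_snd]
  exact Measurable.sub (measurable_multilevelEstimate hV hh le_rfl) (hV.measurable_F.comp hh)

theorem measurable_ghost [SFinite π] (hV : V.MonotoneSetting π L D σ Δ) (hγ : 0 ≤ γ)
    (j : ℕ → ℕ) (k : ℕ) : Measurable[past Z (clock B j k)]
      fun ω => ghost V γ B M x0 (fun i => Z i ω) j k := by
  induction k with
  | zero => exact measurable_const
  | succ k ih =>
    have hi := ih.mono (past_mono Z (show clock B j k ≤ clock B j (k + 1) by
      rw [clock]; omega)) le_rfl
    exact hV.measurable_proj.comp
      (Measurable.add hi ((measurable_const_smul γ).comp (measurable_levelError hV hγ j k)))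

/-- With `Z` the coordinate process on `ℕ → S`, adaptedness becomes measurability in the path, as
`integral_eq` requires. -/
theorem past_eval_le (n : ℕ) :
    past (fun i (z : ℕ → S) => z i) n ≤ (inferInstance : MeasurableSpace (ℕ → S)) :=
  iSup₂_le fun i _ => (measurable_pi_apply i).comap_le

end Adapted

/-! ### Moments of the multilevel estimate -/

section IterationMoments

variable {d : ℕ} {S : Type*} {V : VIData d S} {γ : ℝ} {B : ℕ} {M : ℝ} {x0 : Vec d} {m : ℕ}

/-- The correlation of the batch error at level `l` with the distance to the auxiliary sequence. -/
def levelCorr (V : VIData d S) (γ : ℝ) (B : ℕ) (M : ℝ) (x0 : Vec d) (k l : ℕ) (j : ℕ → ℕ)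
    (z : ℕ → S) : ℝ :=
  inner ℝ (batchMean V z (halfIterate V γ B M x0 z j k) (clock B j k + B) (2 ^ l * B)
    - V.F (halfIterate V γ B M x0 z j k)) (ghost V γ B M x0 z j k - halfIterate V γ B M x0 z j k)

theorem levelCorr_congr (k l : ℕ) {j j' : ℕ → ℕ} (h : ∀ i < k, j i = j' i) :
    levelCorr V γ B M x0 k l j = levelCorr V γ B M x0 k l j' := by
  ext z
  rw [levelCorr, levelCorr, halfIterate_congr z h, clock_congr B h, ghost_congr z h]

/-- Written as a sum over the values of the level, the correction can be averaged level by level and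
then telescopes. -/
theorem inner_levelError_eq (hM : ∀ l : ℕ, (2 : ℝ) ^ l ≤ M ↔ l ≤ m) (z : ℕ → S) (j : ℕ → ℕ)
    (k : ℕ) : inner ℝ (levelError V γ B M x0 z j k)
      (ghost V γ B M x0 z j k - halfIterate V γ B M x0 z j k)
      = levelCorr V γ B M x0 k 0 j z + ∑ l ∈ Finset.range m, if j k = l + 1 then
        2 ^ (l + 1) * (levelCorr V γ B M x0 k (l + 1) j z - levelCorr V γ B M x0 k l j z)
        else 0 := by
  have h0 : levelCorr V γ B M x0 k 0 j z = inner ℝ (batchMean V z (halfIterate V γ B M x0 z j k)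
      (clock B j k + B) B - V.F (halfIterate V γ B M x0 z j k))
      (ghost V γ B M x0 z j k - halfIterate V γ B M x0 z j k) := by
    rw [levelCorr, pow_zero, one_mul]
  rw [h0, levelError, multilevelEstimate, add_sub_right_comm, inner_add_left, iterate_snd]
  congr 1
  rcases hj : j k with _ | i
  -- At level `0` the truncated subtraction `0 - 1 = 0` makes the two batches equal, so the
  -- correction vanishes.
  · simp
  · simp only [Nat.add_right_cancel_iff, Finset.sum_ite_eq, Finset.mem_range, hM,
      Nat.add_sub_cancel, Nat.succ_le_iff]
    split_ifs with h
    · rw [real_inner_smul_left, ← sub_sub_sub_cancel_right _ _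
        (V.F (halfIterate V γ B M x0 z j k)), inner_sub_left]
      rfl
    · simp

theorem norm_sq_levelError_le (z : ℕ → S) (j : ℕ → ℕ) (k : ℕ) :
    ‖levelError V γ B M x0 z j k‖ ^ 2 ≤
      2 * ‖batchMean V z (halfIterate V γ B M x0 z j k) (clock B j k + B) B
        - V.F (halfIterate V γ B M x0 z j k)‖ ^ 2
      + (if (2 : ℝ) ^ j k ≤ M then 4 * (2 ^ j k) ^ 2 else 0) *
      (‖batchMean V z (halfIterate V γ B M x0 z j k) (clock B j k + B) (2 ^ j k * B)
        - V.F (halfIterate V γ B M x0 z j k)‖ ^ 2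
      + ‖batchMean V z (halfIterate V γ B M x0 z j k) (clock B j k + B) (2 ^ (j k - 1) * B)
        - V.F (halfIterate V γ B M x0 z j k)‖ ^ 2) := by
  have hsq : ∀ a b : Vec d, ‖a + b‖ ^ 2 ≤ 2 * ‖a‖ ^ 2 + 2 * ‖b‖ ^ 2 := fun a b => by
    have h1 := pow_le_pow_left₀ (norm_nonneg _) (norm_add_le a b) 2
    nlinarith [sq_nonneg (‖a‖ - ‖b‖)]
  rw [levelError, multilevelEstimate, add_sub_right_comm, iterate_snd]
  refine (hsq _ _).trans (add_le_add le_rfl ?_)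
  split_ifs with h
  · rw [norm_smul, Real.norm_of_nonneg (by positivity), mul_pow, ← sub_sub_sub_cancel_right _ _
      (V.F (halfIterate V γ B M x0 z j k)), sub_eq_add_neg (_ - _) (_ - _)]
    have h1 := hsq (batchMean V z (halfIterate V γ B M x0 z j k) (clock B j k + B) (2 ^ j k * B)
        - V.F (halfIterate V γ B M x0 z j k))
      (-(batchMean V z (halfIterate V γ B M x0 z j k) (clock B j k + B) (2 ^ (j k - 1) * B)
        - V.F (halfIterate V γ B M x0 z j k)))
    rw [norm_neg] at h1
    have h2 := mul_le_mul_of_nonneg_left h1 (show (0 : ℝ) ≤ 2 * (2 ^ j k) ^ 2 by positivity)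
    linarith
  · simp

variable [MeasurableSpace S] {π : Measure S} {L D σ Δ : ℝ}

/-- A crude bound that serves integrability only; the factor `2 ^ m` does not enter the moment
estimates. -/
theorem norm_levelError_le (hV : V.MonotoneSetting π L D σ Δ) (hB : 1 ≤ B)
    (hM : ∀ l : ℕ, (2 : ℝ) ^ l ≤ M ↔ l ≤ m) (z : ℕ → S) (j : ℕ → ℕ) (k : ℕ) :
    ‖levelError V γ B M x0 z j k‖ ≤ noiseLevel D σ Δ * (1 + 2 ^ m * 2) := by
  have hx := halfIterate_mem (γ := γ) (B := B) (M := M) (x0 := x0) z j hV k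
  have hb : ∀ l, ‖batchMean V z (halfIterate V γ B M x0 z j k)
      ((iterate V γ B M x0 z j k).2 + B) (2 ^ l * B) - V.F (halfIterate V γ B M x0 z j k)‖
        ≤ noiseLevel D σ Δ := fun l =>
    hV.norm_batchMean_sub_le hx z _ (Nat.mul_pos (by positivity) hB)
  have hb0 := hb 0
  rw [pow_zero, one_mul] at hb0
  have hs := noiseLevel_nonneg D σ Δ
  rw [levelError, multilevelEstimate, add_sub_right_comm, mul_add, mul_one]
  refine (norm_add_le _ _).trans (add_le_add hb0 ?_)
  split_ifs with h
  · rw [norm_smul, Real.norm_of_nonneg (by positivity), ← sub_sub_sub_cancel_right _ _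
      (V.F (halfIterate V γ B M x0 z j k))]
    have h1 := norm_sub_le_of_le (hb (j k)) (hb (j k - 1))
    have h2 : (2 : ℝ) ^ j k ≤ 2 ^ m := pow_le_pow_right₀ (by norm_num) ((hM _).1 h)
    calc _ ≤ 2 ^ m * (noiseLevel D σ Δ + noiseLevel D σ Δ) := by gcongr
      _ = _ := by ring
  · rw [norm_zero]; positivity

theorem abs_levelCorr_le (hV : V.MonotoneSetting π L D σ Δ) (hD : 0 ≤ D) (hx0 : x0 ∈ V.X)
    (hB : 1 ≤ B) (k l : ℕ) (j : ℕ → ℕ) (z : ℕ → S) :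
    |levelCorr V γ B M x0 k l j z| ≤ noiseLevel D σ Δ * D :=
  (abs_real_inner_le_norm _ _).trans
    (mul_le_mul (hV.norm_batchMean_sub_le (halfIterate_mem z j hV k) z _
        (Nat.mul_pos (by positivity) hB))
      (hV.norm_sub_le hD (ghost_mem z j hV hx0 k) (halfIterate_mem z j hV k)) (norm_nonneg _)
      (noiseLevel_nonneg _ _ _))

theorem measurable_levelCorr [SFinite π] (hV : V.MonotoneSetting π L D σ Δ) (hγ : 0 ≤ γ)
    (k l : ℕ) (j : ℕ → ℕ) : Measurable (levelCorr V γ B M x0 k l j) := by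
  let Z : ℕ → (ℕ → S) → S := fun i z => z i
  have hh := (measurable_halfIterate (Z := Z) (B := B) (M := M) (x0 := x0) hV hγ j k)
  have hb := measurable_batchMean (Z := Z) hV (T := clock B j k + B) (n := 2 ^ l * B)
    (hh.mono (past_mono Z (Nat.le_add_right _ (2 ^ l * B))) le_rfl) le_rfl
  have hg := (measurable_ghost (Z := Z) (B := B) (M := M) (x0 := x0) hV hγ j k)
  have hh' := hh.mono (past_eval_le _) le_rfl
  exact ((hb.mono (past_eval_le _) le_rfl).sub (hV.measurable_F.comp hh')).inner
    ((hg.mono (past_eval_le _) le_rfl).sub hh')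

theorem measurable_levelError_path [SFinite π] (hV : V.MonotoneSetting π L D σ Δ) (hγ : 0 ≤ γ)
    (j : ℕ → ℕ) (k : ℕ) : Measurable fun z => levelError V γ B M x0 z j k :=
  (measurable_levelError (Z := fun i (z : ℕ → S) => z i) hV hγ j k).mono (past_eval_le _) le_rfl

variable {Ω : Type*} [MeasurableSpace Ω] {Q : Kernel S S} [IsMarkovKernel Q] {P : Measure Ω}
  [IsProbabilityMeasure P] {Z : ℕ → Ω → S} {J : ℕ → Ω → ℕ} {τ : ℕ}

/-- The randomized estimate is nearly unbiased: its mean is that of the largest batch. -/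
theorem abs_integral_inner_levelError_le (hV : V.MonotoneSetting π L D σ Δ) (hD : 0 ≤ D)
    (hγ : 0 ≤ γ) (hx0 : x0 ∈ V.X) (hQ : UniformlyErgodic Q π τ) (hZ : IsMarkovChain Q P Z)
    (hJ : IsGeometricSampling P J Z) (hM : ∀ l : ℕ, (2 : ℝ) ^ l ≤ M ↔ l ≤ m) (k : ℕ) :
    |∫ ω, inner ℝ (levelError V γ τ M x0 (fun i => Z i ω) (fun i => J i ω) k)
      (ghost V γ τ M x0 (fun i => Z i ω) (fun i => J i ω) k
        - halfIterate V γ τ M x0 (fun i => Z i ω) (fun i => J i ω) k) ∂P|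
      ≤ 8 / 3 * (noiseLevel D σ Δ * D) * (1 / 2 ^ m) := by
  have := hQ.isProbabilityMeasure
  have hτ := hQ.one_le
  have hτ0 : (0 : ℝ) < τ := by positivity
  set α : ℕ → (ℕ → ℕ) → (ℕ → S) → ℝ := levelCorr V γ τ M x0 k
  have hαc : ∀ l j j', (∀ i < k, j i = j' i) → α l j = α l j' := fun l j j' h =>
    levelCorr_congr k l h
  have hαm : ∀ l j, Measurable (α l j) := fun l j => measurable_levelCorr hV hγ k l j
  have hαb : ∀ l j z, |α l j z| ≤ noiseLevel D σ Δ * D := fun l j z =>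
    abs_levelCorr_le hV hD hx0 hτ k l j z
  set I : ℕ → ℝ := fun l => ∫ ω, α l (fun i => J i ω) (fun n => Z n ω) ∂P with hI
  have hαi : ∀ l, Integrable (fun ω => α l (fun i => J i ω) (fun n => Z n ω)) P := fun l =>
    (hJ.integral_eq hZ.measurable k (hαc l) (hαm l) (hαb l)).1
  have hdiff : ∀ l, Integrable (fun ω => if J k ω = l + 1 then 2 ^ (l + 1) *
        (α (l + 1) (fun i => J i ω) (fun n => Z n ω) - α l (fun i => J i ω) (fun n => Z n ω))
        else 0) P ∧
      ∫ ω, (if J k ω = l + 1 then 2 ^ (l + 1) *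
        (α (l + 1) (fun i => J i ω) (fun n => Z n ω) - α l (fun i => J i ω) (fun n => Z n ω))
        else 0) ∂P = I (l + 1) - I l := by
    intro l
    have h := hJ.integral_ite_level hZ.measurable k (l := l + 1) (by omega)
      (G := fun j z => 2 ^ (l + 1) * (α (l + 1) j z - α l j z))
      (K := 2 ^ (l + 1) * (noiseLevel D σ Δ * D + noiseLevel D σ Δ * D))
      (fun j j' h => by rw [hαc _ j j' h, hαc _ j j' h])
      (fun j => ((hαm _ j).sub (hαm _ j)).const_mul _)
      (fun j z => by
        rw [abs_mul, abs_of_pos (by positivity : (0 : ℝ) < 2 ^ (l + 1))]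
        exact mul_le_mul_of_nonneg_left
          ((abs_sub _ _).trans (add_le_add (hαb _ j z) (hαb _ j z))) (by positivity))
    refine ⟨h.1, h.2.trans ?_⟩
    rw [integral_const_mul, integral_sub (hαi _) (hαi _), ← mul_assoc, ← mul_pow]
    norm_num [hI]
  -- The weights cancel the level probabilities, so the sum telescopes and only the largest batch
  -- survives.
  have htot : ∫ ω, inner ℝ (levelError V γ τ M x0 (fun i => Z i ω) (fun i => J i ω) k)
      (ghost V γ τ M x0 (fun i => Z i ω) (fun i => J i ω) k
        - halfIterate V γ τ M x0 (fun i => Z i ω) (fun i => J i ω) k) ∂P = I m := by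
    simp_rw [inner_levelError_eq hM]
    rw [integral_add (hαi 0) (integrable_finsetSum _ fun l _ => (hdiff l).1),
      integral_finsetSum _ fun l _ => (hdiff l).1,
      Finset.sum_congr rfl fun l _ => (hdiff l).2, Finset.sum_range_sub]
    exact add_sub_cancel _ _
  rw [htot, hI]
  simp only
  rw [(hJ.integral_eq hZ.measurable k (hαc m) (hαm m) (hαb m)).2.2]
  have hinner : ∀ j : ℕ → ℕ, |∫ ω, α m j (fun n => Z n ω) ∂P|
      ≤ 8 / 3 * (noiseLevel D σ Δ * D) * (1 / 2 ^ m) := by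
    intro j
    have hh := (measurable_halfIterate (Z := Z) (B := τ) (M := M) (x0 := x0) hV hγ j k)
    have hg := (measurable_ghost (Z := Z) (B := τ) (M := M) (x0 := x0) hV hγ j k)
    have h := abs_integral_inner_batchMean_le hV hQ hZ (T := clock τ j k + τ) (n := 2 ^ m * τ)
      (Nat.mul_pos (by positivity) hτ) hh (fun ω => halfIterate_mem _ j hV k)
      (Measurable.sub (hg.mono (past_mono Z (Nat.le_add_right _ τ)) le_rfl) hh) hD
      (fun ω => hV.norm_sub_le hD (ghost_mem _ j hV hx0 k) (halfIterate_mem _ j hV k))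
    refine h.trans (le_of_eq ?_)
    push_cast
    field_simp
  simpa using norm_integral_le_of_norm_le_const (μ := P)
    (f := fun ω' => ∫ ω, α m (fun i => J i ω') (fun n => Z n ω) ∂P)
    (ae_of_all _ fun ω' => hinner _)

/-- The randomized estimate has logarithmic second moment. -/
theorem integral_norm_sq_levelError_le (hV : V.MonotoneSetting π L D σ Δ)
    (hγ : 0 ≤ γ) (hQ : UniformlyErgodic Q π τ) (hZ : IsMarkovChain Q P Z)
    (hJ : IsGeometricSampling P J Z) (hM : ∀ l : ℕ, (2 : ℝ) ^ l ≤ M ↔ l ≤ m) (k : ℕ) :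
    Integrable (fun ω => ‖levelError V γ τ M x0 (fun i => Z i ω) (fun i => J i ω) k‖ ^ 2) P ∧
    ∫ ω, ‖levelError V γ τ M x0 (fun i => Z i ω) (fun i => J i ω) k‖ ^ 2 ∂P
      ≤ 84 * noiseLevel D σ Δ ^ 2 * (1 + m) := by
  have := hQ.isProbabilityMeasure
  have hτ := hQ.one_le
  have hτ0 : (0 : ℝ) < τ := by positivity
  set s := noiseLevel D σ Δ with hs
  have h := hJ.integral_eq hZ.measurable (k + 1)
    (G := fun j z => ‖levelError V γ τ M x0 z j k‖ ^ 2) (K := (s * (1 + 2 ^ m * 2)) ^ 2)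
    (fun j j' h => by ext z; rw [levelError_congr z h])
    (fun j => (measurable_levelError_path hV hγ j k).norm.pow_const 2)
    (fun j z => by
      rw [abs_of_nonneg (by positivity)]
      exact pow_le_pow_left₀ (norm_nonneg _) (norm_levelError_le hV hτ hM z j k) 2)
  refine ⟨h.1, ?_⟩
  -- For frozen levels the correction costs `4 * 4^j` times the two batch variances `6 s² 2^{-j}`
  -- and at most `12 s² 2^{-j}`, that is `72 s² 2^j`.
  have hcond : ∀ j : ℕ → ℕ, ∫ ω, ‖levelError V γ τ M x0 (fun i => Z i ω) j k‖ ^ 2 ∂P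
      ≤ 12 * s ^ 2 + 72 * s ^ 2 * (if (2 : ℝ) ^ j k ≤ M then 2 ^ j k else 0) := by
    intro j
    have hh := (measurable_halfIterate (Z := Z) (B := τ) (M := M) (x0 := x0) hV hγ j k)
    have hb : ∀ l : ℕ, Integrable (fun ω => ‖batchMean V (fun i => Z i ω)
          (halfIterate V γ τ M x0 (fun i => Z i ω) j k) (clock τ j k + τ) (2 ^ l * τ)
          - V.F (halfIterate V γ τ M x0 (fun i => Z i ω) j k)‖ ^ 2) P ∧
        ∫ ω, ‖batchMean V (fun i => Z i ω)
          (halfIterate V γ τ M x0 (fun i => Z i ω) j k) (clock τ j k + τ) (2 ^ l * τ)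
          - V.F (halfIterate V γ τ M x0 (fun i => Z i ω) j k)‖ ^ 2 ∂P
          ≤ 6 * s ^ 2 * (1 / 2 ^ l) := by
      intro l
      have hl : 1 ≤ 2 ^ l * τ := Nat.mul_pos (by positivity) hτ
      constructor
      · have hbm := measurable_batchMean hV (T := clock τ j k + τ) (n := 2 ^ l * τ)
          (hh.mono (past_mono Z (Nat.le_add_right _ (2 ^ l * τ))) le_rfl) le_rfl
        refine Integrable.of_bound (C := s ^ 2) (((hbm.mono (hZ.past_le _) le_rfl).sub
          (hV.measurable_F.comp (hh.mono (hZ.past_le _) le_rfl))).norm.pow_const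
            2).aestronglyMeasurable (ae_of_all _ fun ω => ?_)
        rw [Real.norm_of_nonneg (by positivity)]
        exact pow_le_pow_left₀ (norm_nonneg _)
          (hV.norm_batchMean_sub_le (halfIterate_mem _ j hV k) _ _ hl) 2
      · refine (integral_norm_sq_batchMean_le hV hQ hZ hl hh
          (fun ω => halfIterate_mem _ j hV k)).trans (le_of_eq ?_)
        rw [← hs]
        push_cast
        field_simp
    have hb0 := hb 0
    simp only [pow_zero, one_mul] at hb0
    refine (integral_mono_of_nonneg (ae_of_all _ fun ω => by positivity)
      ((hb0.1.const_mul 2).add (((hb (j k)).1.add (hb (j k - 1)).1).const_mul _))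
      (ae_of_all _ fun ω => norm_sq_levelError_le _ j k)).trans ?_
    rw [integral_add' (hb0.1.const_mul 2) (((hb (j k)).1.add (hb (j k - 1)).1).const_mul _),
      integral_const_mul, integral_const_mul, integral_add' (hb (j k)).1 (hb (j k - 1)).1]
    have hpos : (0 : ℝ) < 2 ^ j k := by positivity
    have hhalf : (1 : ℝ) / 2 ^ (j k - 1) ≤ 2 * (1 / 2 ^ j k) := by
      rw [div_le_iff₀ (by positivity), mul_one_div, div_mul_eq_mul_div, le_div_iff₀ hpos, one_mul,
        ← pow_succ']
      exact pow_le_pow_right₀ (by norm_num) (by omega)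
    have h1 := (hb (j k)).2
    have h2 := (hb (j k - 1)).2
    have h3 := mul_le_mul_of_nonneg_left hhalf (show 0 ≤ 6 * s ^ 2 by positivity)
    split_ifs with hc
    · have h4 := mul_le_mul_of_nonneg_left (add_le_add h1 (h2.trans h3))
        (show (0 : ℝ) ≤ 4 * (2 ^ j k) ^ 2 by positivity)
      have e : 4 * (2 ^ j k : ℝ) ^ 2 * (6 * s ^ 2 * (1 / 2 ^ j k) + 6 * s ^ 2 * (2 * (1 / 2 ^ j k)))
          = 72 * s ^ 2 * 2 ^ j k := by field_simp; ring
      rw [e] at h4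
      have := hb0.2
      norm_num at this
      linarith
    · have := hb0.2
      norm_num at this
      linarith
  have hlev := hJ.integral_two_pow_le k hM
  rw [h.2.2]
  refine (integral_mono h.2.1 ((integrable_const (12 * s ^ 2)).add (hlev.1.const_mul (72 * s ^ 2)))
    fun ω' => hcond _).trans ?_
  rw [integral_add' (integrable_const _) (hlev.1.const_mul _), integral_const, probReal_univ,
    one_smul, integral_const_mul]
  have h1 := mul_le_mul_of_nonneg_left hlev.2 (show 0 ≤ 72 * s ^ 2 by positivity)
  have : 0 ≤ s ^ 2 * m := by positivity
  nlinarith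

end IterationMoments

/-! ### Measurability and boundedness of the gap -/

section Gap

variable {d : ℕ} {S : Type*} [MeasurableSpace S] {V : VIData d S} {π : Measure S} {L D σ Δ : ℝ}

theorem VIData.MonotoneSetting.continuousOn_F (hV : V.MonotoneSetting π L D σ Δ) (hL : 0 ≤ L) :
    ContinuousOn V.F V.X :=
  (LipschitzOnWith.of_dist_le_mul (K := L.toNNReal) fun x hx y hy => by
    rw [dist_eq_norm, dist_eq_norm, Real.coe_toNNReal L hL]
    exact hV.lipschitz x hx y hy).continuousOn

theorem VIData.MonotoneSetting.continuousOn_gap_term (hV : V.MonotoneSetting π L D σ Δ)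
    (hL : 0 ≤ L) : ContinuousOn
      (fun p : Vec d × Vec d => inner ℝ (V.F p.2) (p.1 - p.2) + V.r p.1 - V.r p.2)
      (V.X ×ˢ V.X) := by
  have hF : ContinuousOn (fun p : Vec d × Vec d => V.F p.2) (V.X ×ˢ V.X) :=
    (hV.continuousOn_F hL).comp continuousOn_snd fun p hp => hp.2
  have h1 : Continuous fun p : Vec d × Vec d => p.1 - p.2 := continuous_fst.sub continuous_snd
  exact ((hF.inner (𝕜 := ℝ) h1.continuousOn).add (hV.continuous_r.comp continuous_fst).continuousOn).sub
    (hV.continuous_r.comp continuous_snd).continuousOn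

theorem VIData.MonotoneSetting.bddAbove_gap (hV : V.MonotoneSetting π L D σ Δ) (hL : 0 ≤ L)
    (x : Vec d) :
    BddAbove (Set.range fun y : V.X => inner ℝ (V.F y) (x - y) + V.r x - V.r y) := by
  have hc : ContinuousOn (fun y => inner ℝ (V.F y) (x - y) + V.r x - V.r y) V.X :=
    (((hV.continuousOn_F hL).inner (𝕜 := ℝ) (continuous_const.sub continuous_id).continuousOn).add
      continuousOn_const).sub hV.continuous_r.continuousOn
  have h := hV.isCompact_X.bddAbove_image hc
  rwa [Set.image_eq_range] at h

/-- The supremum is over an uncountable set, but a supremum of continuous functions is lower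
semicontinuous. -/
theorem VIData.MonotoneSetting.measurable_gap (hV : V.MonotoneSetting π L D σ Δ) (hL : 0 ≤ L) :
    Measurable V.gap := by
  refine (lowerSemicontinuous_ciSup (f := fun (y : V.X) (x : Vec d) =>
    inner ℝ (V.F y) (x - y) + V.r x - V.r y) (hV.bddAbove_gap hL) fun y => ?_).measurable
  have := hV.continuous_r
  exact Continuous.lowerSemicontinuous (by fun_prop)

theorem VIData.MonotoneSetting.exists_abs_gap_le (hV : V.MonotoneSetting π L D σ Δ) (hL : 0 ≤ L) :
    ∃ K, ∀ x ∈ V.X, |V.gap x| ≤ K := by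
  have : Nonempty V.X := hV.nonempty_X.to_subtype
  obtain ⟨K, hK⟩ := (hV.isCompact_X.prod hV.isCompact_X).bddAbove_image
    (hV.continuousOn_gap_term hL)
  refine ⟨K, fun x hx => ?_⟩
  have h0 : 0 ≤ V.gap x := by
    refine le_trans (le_of_eq ?_) (le_ciSup (hV.bddAbove_gap hL x) ⟨x, hx⟩)
    simp
  rw [abs_of_nonneg h0]
  exact ciSup_le fun y => hK ⟨(x, y), ⟨hx, y.2⟩, rfl⟩

end Gap

/-! ### Expected gap and expected cost -/

section Expectation

variable {d : ℕ} {S : Type*} [MeasurableSpace S] {V : VIData d S} {π : Measure S} {L D σ Δ : ℝ}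
  {γ : ℝ} {M : ℝ} {x0 : Vec d} {m : ℕ}

theorem measurable_averagedOutput {B : ℕ} (hV : V.MonotoneSetting π L D σ Δ) (hγ : 0 ≤ γ)
    (N : ℕ) (j : ℕ → ℕ) : Measurable fun z => averagedOutput V γ B M N x0 z j := by
  unfold averagedOutput
  refine (measurable_const_smul (N : ℝ)⁻¹).comp (Finset.measurable_fun_sum _ fun k _ => ?_)
  exact (measurable_halfIterate (Z := fun i (z : ℕ → S) => z i) (B := B) (M := M) (x0 := x0)
    hV hγ j k).mono (past_eval_le _) le_rfl

variable {Ω : Type*} [MeasurableSpace Ω] {Q : Kernel S S} [IsMarkovKernel Q] {P : Measure Ω}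
  [IsProbabilityMeasure P] {Z : ℕ → Ω → S} {J : ℕ → Ω → ℕ} {τ : ℕ}

/-- The constant `170` rounds up `2 * 84 + 3 / 2`. -/
theorem integral_stepError_le (hV : V.MonotoneSetting π L D σ Δ) (hD : 0 ≤ D)
    (hγ : 0 ≤ γ) (hx0 : x0 ∈ V.X) (hQ : UniformlyErgodic Q π τ) (hZ : IsMarkovChain Q P Z)
    (hJ : IsGeometricSampling P J Z) (hM : ∀ l : ℕ, (2 : ℝ) ^ l ≤ M ↔ l ≤ m) (k : ℕ) :
    Integrable (fun ω => stepError V γ τ M x0 (fun i => Z i ω) (fun i => J i ω)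
      (noiseLevel D σ Δ) k) P ∧
    ∫ ω, stepError V γ τ M x0 (fun i => Z i ω) (fun i => J i ω) (noiseLevel D σ Δ) k ∂P
      ≤ 170 * γ ^ 2 * noiseLevel D σ Δ ^ 2 * (1 + m)
        + γ * (8 / 3 * (noiseLevel D σ Δ * D) * (1 / 2 ^ m)) := by
  have := hQ.isProbabilityMeasure
  have hsq := integral_norm_sq_levelError_le (x0 := x0) hV hγ hQ hZ hJ hM k
  have hin := abs_integral_inner_levelError_le hV hD hγ hx0 hQ hZ hJ hM k
  have hii := (hJ.integral_eq hZ.measurable (k + 1)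
    (G := fun j z => inner ℝ (levelError V γ τ M x0 z j k)
      (ghost V γ τ M x0 z j k - halfIterate V γ τ M x0 z j k))
    (K := noiseLevel D σ Δ * (1 + 2 ^ m * 2) * D)
    (fun j j' h => by
      ext z
      rw [levelError_congr z h, ghost_congr z fun i hi => h i (by omega),
        halfIterate_congr z fun i hi => h i (by omega)])
    (fun j => (measurable_levelError_path hV hγ j k).inner
      (((measurable_ghost (Z := fun i (z : ℕ → S) => z i) hV hγ j k).mono
          (past_eval_le _) le_rfl).sub
        ((measurable_halfIterate (Z := fun i (z : ℕ → S) => z i) hV hγ j k).mono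
          (past_eval_le _) le_rfl)))
    (fun j z => (abs_real_inner_le_norm _ _).trans
      (mul_le_mul (norm_levelError_le hV hQ.one_le hM z j k)
        (hV.norm_sub_le hD (ghost_mem z j hV hx0 k) (halfIterate_mem z j hV k)) (norm_nonneg _)
        (mul_nonneg (noiseLevel_nonneg _ _ _) (by positivity))))).1
  have h1 := hsq.1.const_mul (2 * γ ^ 2)
  have h2 : Integrable (fun _ : Ω => 3 / 2 * γ ^ 2 * noiseLevel D σ Δ ^ 2) P := integrable_const _
  have h3 := hii.const_mul γ
  refine ⟨(h1.add h2).add h3, ?_⟩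
  have e := integral_add' (h1.add h2) h3
  rw [integral_add' h1 h2, integral_const_mul, integral_const, probReal_univ, one_smul,
    integral_const_mul] at e
  refine e.le.trans ?_
  have h4 := mul_le_mul_of_nonneg_left hsq.2 (show 0 ≤ 2 * γ ^ 2 by positivity)
  have h5 := mul_le_mul_of_nonneg_left ((le_abs_self _).trans hin) hγ
  have h6 : 0 ≤ γ ^ 2 * noiseLevel D σ Δ ^ 2 * m := by positivity
  have h7 : 0 ≤ γ ^ 2 * noiseLevel D σ Δ ^ 2 := by positivity
  nlinarith

/-- Division by `γ * N` turns the summed errors into averages, so the bias enters once and does not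
accumulate over the iterations. -/
theorem integral_gap_le (hV : V.MonotoneSetting π L D σ Δ) (hD : 0 ≤ D) (hL : 0 ≤ L)
    (hγ : 0 < γ) (hγL : γ * L ≤ 1 / 3) (hx0 : x0 ∈ V.X) (hQ : UniformlyErgodic Q π τ)
    (hZ : IsMarkovChain Q P Z) (hJ : IsGeometricSampling P J Z)
    (hM : ∀ l : ℕ, (2 : ℝ) ^ l ≤ M ↔ l ≤ m) {N : ℕ} (hN : 1 ≤ N) :
    Integrable (fun ω => V.gap (averagedOutput V γ τ M N x0 (fun n => Z n ω) fun k => J k ω)) P ∧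
    ∫ ω, V.gap (averagedOutput V γ τ M N x0 (fun n => Z n ω) fun k => J k ω) ∂P
      ≤ D ^ 2 / (γ * N) + 170 * γ * noiseLevel D σ Δ ^ 2 * (1 + m)
        + 8 / 3 * (noiseLevel D σ Δ * D) * (1 / 2 ^ m) := by
  obtain ⟨K, hK⟩ := hV.exists_abs_gap_le hL
  have hN0 : (0 : ℝ) < N := by positivity
  have hgi := (hJ.integral_eq hZ.measurable N
    (G := fun j z => V.gap (averagedOutput V γ τ M N x0 z j)) (K := K)
    (fun j j' h => by ext z; rw [averagedOutput_congr z h])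
    (fun j => (hV.measurable_gap hL).comp (measurable_averagedOutput hV hγ.le N j))
    (fun j z => hK _ (averagedOutput_mem z j hV hN))).1
  refine ⟨hgi, ?_⟩
  have hst := fun k => integral_stepError_le hV hD hγ.le hx0 hQ hZ hJ hM k
  have hsum := integrable_finsetSum (Finset.range N) fun k _ => (hst k).1
  refine (integral_mono hgi (((integrable_const (D ^ 2)).add hsum).const_mul (γ * N)⁻¹)
    fun ω => gap_averagedOutput_le _ _ hV hx0 hQ.one_le hL hγ hγL hN).trans ?_
  rw [integral_const_mul, integral_add' (integrable_const _) hsum, integral_const, probReal_univ,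
    one_smul, integral_finsetSum _ fun k _ => (hst k).1]
  have h1 := Finset.sum_le_sum fun k (_ : k ∈ Finset.range N) => (hst k).2
  rw [Finset.sum_const, Finset.card_range, nsmul_eq_mul] at h1
  have h2 := mul_le_mul_of_nonneg_left (add_le_add (le_refl (D ^ 2)) h1)
    (show 0 ≤ (γ * N)⁻¹ by positivity)
  refine h2.trans (le_of_eq ?_)
  field_simp
  ring

theorem integral_oracleCalls_le (hJ : IsGeometricSampling P J Z)
    (hM : ∀ l : ℕ, (2 : ℝ) ^ l ≤ M ↔ l ≤ m) (B N : ℕ) :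
    Integrable (fun ω => (oracleCalls B M N (fun k => J k ω) : ℝ)) P ∧
    ∫ ω, (oracleCalls B M N (fun k => J k ω) : ℝ) ∂P ≤ N * (B * (3 + m)) := by
  have hB : (0 : ℝ) ≤ B := by positivity
  set f : ℕ → ℝ := fun l => B + if (2 : ℝ) ^ l ≤ M then 2 ^ l * (B : ℝ) else B with hf
  have hfle : ∀ l, f l ≤ 2 * B + B * (if (2 : ℝ) ^ l ≤ M then 2 ^ l else 0) := by
    intro l
    simp only [hf]
    split_ifs <;> linarith
  have hf0 : ∀ l, 0 ≤ f l := by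
    intro l
    simp only [hf]
    split_ifs <;> positivity
  have hlev := fun k => hJ.integral_two_pow_le k hM
  have hdom := fun k => (integrable_const (μ := P) (2 * (B : ℝ))).add ((hlev k).1.const_mul B)
  have hfi : ∀ k, Integrable (fun ω => f (J k ω)) P := fun k =>
    (hdom k).mono' ((measurable_of_countable f).comp (hJ.measurable k)).aestronglyMeasurable
      (ae_of_all _ fun ω => by rw [Real.norm_of_nonneg (hf0 _)]; exact hfle _)
  have e : (fun ω => (oracleCalls B M N (fun k => J k ω) : ℝ))
      = fun ω => ∑ k ∈ Finset.range N, f (J k ω) := by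
    ext ω
    simp only [oracleCalls, hf]
    push_cast
    rfl
  rw [e]
  refine ⟨integrable_finsetSum _ fun k _ => hfi k, ?_⟩
  rw [integral_finsetSum _ fun k _ => hfi k]
  have hk : ∀ k ∈ Finset.range N, ∫ ω, f (J k ω) ∂P ≤ B * (3 + m) := by
    intro k _
    refine (integral_mono (hfi k) (hdom k) fun ω => hfle _).trans ?_
    rw [integral_add' (integrable_const _) ((hlev k).1.const_mul _), integral_const,
      probReal_univ, one_smul, integral_const_mul]
    have := mul_le_mul_of_nonneg_left (hlev k).2 hB
    linarith
  refine (Finset.sum_le_sum hk).trans (le_of_eq ?_)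
  rw [Finset.sum_const, Finset.card_range, nsmul_eq_mul]

end Expectation

/-! ### Choice of the number of iterations -/

section Parameters

theorem succ_sq_le_four_mul_two_pow (n : ℕ) : (1 + n : ℝ) ^ 2 ≤ 4 * 2 ^ n := by
  have h : (1 + n) ^ 2 ≤ 4 * 2 ^ n := by
    rcases Nat.lt_or_ge n 2 with h | h
    · interval_cases n <;> norm_num
    · induction n, h using Nat.le_induction with
      | base => norm_num
      | succ n hn ih => rw [pow_succ 2]; nlinarith
  exact_mod_cast h

/-- An exponent `q` for which `4 ^ q` dominates `(1 + q) ^ 2` times a given quantity, and is not much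
larger than necessary. -/
theorem exists_exponent {K : ℝ} (hK : 1 ≤ K) : ∃ C : ℝ, 0 < C ∧ ∀ A : ℝ, 0 ≤ A → ∃ q : ℕ,
    4 * K ^ 2 * max 1 A * (1 + q) ^ 2 ≤ 4 ^ q ∧
    4 ^ q * (3 + q) ≤ C * max 1 A * Real.log (2 + A) ^ 3 := by
  have hl2 : 0 < Real.log 2 := Real.log_pos (by norm_num)
  have hK2 : 1 ≤ K ^ 2 := one_le_pow₀ hK
  have hlK : 0 ≤ Real.log (16 * K ^ 2) := Real.log_nonneg (by linarith)
  set E : ℝ := (Real.log (16 * K ^ 2) / Real.log 2 + 1) / Real.log 2 + 4 / Real.log 2 with hE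
  have hEpos : 0 < E := by positivity
  refine ⟨16 * K ^ 2 * E ^ 3, by positivity, fun A hA => ?_⟩
  set A' := max 1 A with hA'
  have hA1 : 1 ≤ A' := le_max_left _ _
  set Λ := 4 * K ^ 2 * A' with hΛ
  have hΛ4 : 4 ≤ Λ := by
    have : 1 ≤ K ^ 2 * A' := one_le_mul_of_one_le_of_one_le hK2 hA1
    linarith
  set ℓ := Real.log (2 + A) with hℓ
  have hℓ2 : Real.log 2 ≤ ℓ := Real.log_le_log (by norm_num) (by linarith)
  have hℓ0 : 0 < ℓ := hl2.trans_le hℓ2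
  have hℓA : Real.log A' ≤ ℓ := Real.log_le_log (by linarith) (max_le (by linarith) (by linarith))
  have hex : ∃ q : ℕ, Λ * (1 + q) ^ 2 ≤ 4 ^ q := by
    obtain ⟨q, hq⟩ := pow_unbounded_of_one_lt (4 * Λ) (by norm_num : (1 : ℝ) < 2)
    refine ⟨q, ?_⟩
    have h1 := succ_sq_le_four_mul_two_pow q
    calc Λ * (1 + q) ^ 2 ≤ Λ * (4 * 2 ^ q) := by gcongr
      _ = 4 * Λ * 2 ^ q := by ring
      _ ≤ 2 ^ q * 2 ^ q := by gcongr
      _ = 4 ^ q := by rw [← mul_pow]; norm_num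
  classical
  -- Taking the least exponent makes `4 ^ q` overshoot the threshold by a constant factor only, up
  -- to a shift in the polynomial.
  refine ⟨Nat.find hex, Nat.find_spec hex, ?_⟩
  set q := Nat.find hex with hq
  have hbound : (4 : ℝ) ^ q ≤ 4 * Λ * (3 + q) ^ 2 ∧ (3 + q : ℝ) ≤ E * ℓ := by
    have h4 : 4 ≤ 4 / Real.log 2 * ℓ := by
      rw [div_mul_eq_mul_div, le_div_iff₀ hl2]; linarith
    rcases hq0 : q with _ | q'
    · constructor
      · norm_num; linarith
      · have h1 : 0 ≤ (Real.log (16 * K ^ 2) / Real.log 2 + 1) / Real.log 2 * ℓ := by positivity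
        rw [hE, add_mul]
        push_cast
        linarith
    · have hmin : (4 : ℝ) ^ q' < Λ * (1 + q') ^ 2 := by
        have := Nat.find_min hex (m := q') (by omega)
        exact lt_of_not_ge this
      constructor
      · rw [pow_succ]
        push_cast
        have h1 : (1 + q' : ℝ) ^ 2 ≤ (3 + (q' + 1)) ^ 2 := by gcongr <;> linarith
        have h2 := mul_le_mul_of_nonneg_left h1 (show 0 ≤ Λ by linarith)
        linarith
      -- One factor `2 ^ q'` of `4 ^ q'` absorbs the polynomial; the other is then at most `16 * K ^
      -- 2 * A'`, so `q'` is logarithmic in `A'`.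
      · have h1 := succ_sq_le_four_mul_two_pow q'
        have h2 : (2 : ℝ) ^ q' * 2 ^ q' ≤ (16 * K ^ 2 * A') * 2 ^ q' := by
          calc (2 : ℝ) ^ q' * 2 ^ q' = 4 ^ q' := by rw [← mul_pow]; norm_num
            _ ≤ Λ * (1 + q') ^ 2 := hmin.le
            _ ≤ Λ * (4 * 2 ^ q') := by gcongr
            _ = _ := by rw [hΛ]; ring
        have h3 := le_of_mul_le_mul_right h2 (by positivity)
        have h4' := Real.log_le_log (by positivity) h3
        rw [Real.log_pow, Real.log_mul (by positivity) (by positivity)] at h4'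
        have h5 : Real.log (16 * K ^ 2) ≤ Real.log (16 * K ^ 2) / Real.log 2 * ℓ := by
          rw [div_mul_eq_mul_div, le_div_iff₀ hl2]; gcongr
        have h6 : (q' : ℝ) ≤ (Real.log (16 * K ^ 2) / Real.log 2 + 1) / Real.log 2 * ℓ := by
          rw [div_mul_eq_mul_div, le_div_iff₀ hl2]; linarith
        rw [hE, add_mul]
        push_cast
        linarith
  calc (4 : ℝ) ^ q * (3 + q) ≤ 4 * Λ * (3 + q) ^ 2 * (3 + q) := by gcongr; exact hbound.1
    _ = 4 * Λ * (3 + q) ^ 3 := by ring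
    _ ≤ 4 * Λ * (E * ℓ) ^ 3 := by gcongr; exact hbound.2
    _ = _ := by rw [hΛ]; ring

variable {L D σ Δ : ℝ}

theorem sqrt_four_pow (q : ℕ) : Real.sqrt ((4 ^ q : ℕ) : ℝ) = 2 ^ q := by
  rw [show ((4 ^ q : ℕ) : ℝ) = (2 ^ q) ^ 2 by push_cast; rw [← pow_mul, mul_comm, pow_mul]; norm_num]
  exact Real.sqrt_sq (by positivity)

theorem stepScale_four_pow (hD : 0 < D) (hs : noiseLevel D σ Δ ≠ 0) (q : ℕ) :
    stepScale L D σ Δ (4 ^ q) = min (1 / L) (D / (noiseLevel D σ Δ * 2 ^ q)) := by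
  rw [stepScale, ← noiseLevel_sq, if_neg (pow_ne_zero 2 hs), Real.sqrt_div (sq_nonneg D),
    Real.sqrt_mul (sq_nonneg _), Real.sqrt_sq hD.le, Real.sqrt_sq (noiseLevel_nonneg _ _ _),
    sqrt_four_pow]

theorem stepScale_of_noiseLevel_eq_zero (hs : noiseLevel D σ Δ = 0) (N : ℕ) :
    stepScale L D σ Δ N = 1 / L := by
  rw [stepScale, ← noiseLevel_sq, hs, if_pos (by norm_num)]

/-- The last bound is the reciprocal of a minimum estimated by the sum of the reciprocals; it
controls `D ^ 2 / (γ * N)` from above. -/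
theorem stepScale_bounds (hL : 0 < L) (hD : 0 < D) (q : ℕ) :
    0 < stepScale L D σ Δ (4 ^ q) ∧ stepScale L D σ Δ (4 ^ q) * L ≤ 1 ∧
    stepScale L D σ Δ (4 ^ q) * (noiseLevel D σ Δ * 2 ^ q) ≤ D ∧
    D ≤ stepScale L D σ Δ (4 ^ q) * (L * D + noiseLevel D σ Δ * 2 ^ q) := by
  by_cases hs : noiseLevel D σ Δ = 0
  · rw [stepScale_of_noiseLevel_eq_zero hs, hs]
    refine ⟨by positivity, ?_, by simpa using hD.le, ?_⟩
    · field_simp; exact le_rfl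
    · field_simp; simp
  · rw [stepScale_four_pow hD hs]
    have hs0 : 0 < noiseLevel D σ Δ := lt_of_le_of_ne (noiseLevel_nonneg _ _ _) (Ne.symm hs)
    have hs1 : 0 < noiseLevel D σ Δ * 2 ^ q := by positivity
    refine ⟨lt_min (by positivity) (by positivity), ?_, ?_, ?_⟩
    · exact (mul_le_mul_of_nonneg_right (min_le_left _ _) hL.le).trans (by field_simp; exact le_rfl)
    · exact (mul_le_mul_of_nonneg_right (min_le_right _ _) hs1.le).trans
        (by rw [div_mul_cancel₀ _ hs1.ne'])
    · rcases min_choice (1 / L) (D / (noiseLevel D σ Δ * 2 ^ q)) with h | h <;> rw [h]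
      · rw [mul_add, ← mul_assoc, one_div_mul_cancel hL.ne', one_mul]
        linarith [show 0 ≤ 1 / L * (noiseLevel D σ Δ * 2 ^ q) by positivity]
      · rw [mul_add, div_mul_cancel₀ _ hs1.ne']
        linarith [show 0 ≤ D / (noiseLevel D σ Δ * 2 ^ q) * (L * D) by positivity]

theorem complexity_eq (L D σ Δ ε : ℝ) :
    complexity L D σ Δ ε = L * D ^ 2 / ε + (noiseLevel D σ Δ * D / ε) ^ 2 := by
  rw [complexity, div_pow, mul_pow, noiseLevel_sq]; ring

/-- The bound on the expected gap is at most `ε` for the chosen number of iterations. -/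
theorem gap_bound_le {c₁ γ ε : ℝ} (hc₁ : 0 < c₁) (hL : 0 < L) (hD : 0 < D) (hε : 0 < ε) {q : ℕ}
    (hlo : c₁ * stepScale L D σ Δ (4 ^ q) ≤ γ) (hhi : γ ≤ 1 / 3 * stepScale L D σ Δ (4 ^ q))
    (hq : 4 * (1 / c₁ + 60) ^ 2 * max 1 (complexity L D σ Δ ε) * (1 + q) ^ 2 ≤ 4 ^ q) :
    D ^ 2 / (γ * (4 ^ q : ℕ)) + 170 * γ * noiseLevel D σ Δ ^ 2 * (1 + q)
        + 8 / 3 * (noiseLevel D σ Δ * D) * (1 / 2 ^ q) ≤ ε := by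
  obtain ⟨hpos, -, hsD, hDle⟩ := stepScale_bounds (σ := σ) (Δ := Δ) hL hD q
  set S := stepScale L D σ Δ (4 ^ q)
  have hs := noiseLevel_nonneg D σ Δ
  have hA := complexity_eq L D σ Δ ε
  set A := complexity L D σ Δ ε
  set s := noiseLevel D σ Δ
  -- `60 = 57 + 3`: the variance term costs `170 / 3 ≤ 57` and the bias term `8 / 3 ≤ 3`, both in
  -- units of `(1 + q) * (s * D / t)`.
  set K := 1 / c₁ + 60 with hK
  have hc : 0 < 1 / c₁ := by positivity
  have hK60 : 60 ≤ K := by linarith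
  set t : ℝ := 2 ^ q with ht
  have ht0 : 0 < t := by positivity
  have h4 : (4 : ℝ) ^ q = t ^ 2 := by rw [ht, ← pow_mul, mul_comm, pow_mul]; norm_num
  have hq0 : (0 : ℝ) ≤ q := by positivity
  have hγ : 0 < γ := (mul_pos hc₁ hpos).trans_le hlo
  have h1 : D ^ 2 / (γ * (4 ^ q : ℕ)) ≤ 1 / c₁ * (L * D ^ 2 / t ^ 2 + s * D / t) := by
    push_cast
    rw [h4]
    have : 1 / c₁ * (L * D ^ 2 / t ^ 2 + s * D / t)
        = (D * (L * D + s * t)) / (c₁ * t ^ 2) := by field_simp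
    rw [this, div_le_div_iff₀ (by positivity) (by positivity)]
    have h2 : c₁ * D ≤ γ * (L * D + s * t) :=
      calc c₁ * D ≤ c₁ * (S * (L * D + s * t)) := by gcongr
        _ = c₁ * S * (L * D + s * t) := by ring
        _ ≤ γ * (L * D + s * t) := by gcongr
    have h3 := mul_le_mul_of_nonneg_left h2 (show 0 ≤ D * t ^ 2 by positivity)
    linarith
  have h2 : 170 * γ * s ^ 2 * (1 + q) ≤ 57 * (1 + q) * (s * D / t) := by
    have h3 : γ * s ≤ 1 / 3 * (D / t) := by
      rw [mul_div, le_div_iff₀ ht0]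
      have := mul_le_mul_of_nonneg_right hhi (show 0 ≤ s * t by positivity)
      linarith
    have h5 := mul_le_mul_of_nonneg_left h3 (show 0 ≤ 170 * s * (1 + q) by positivity)
    have h6 : 0 ≤ (1 + q) * (s * D / t) := by positivity
    have e : 170 * s * (1 + q) * (1 / 3 * (D / t)) = 170 / 3 * ((1 + q) * (s * D / t)) := by ring
    rw [e] at h5
    nlinarith
  have h3 : 8 / 3 * (s * D) * (1 / t) ≤ 3 * (1 + q) * (s * D / t) := by
    have h6 : 0 ≤ s * D / t := by positivity
    have e : 8 / 3 * (s * D) * (1 / t) = 8 / 3 * (s * D / t) := by ring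
    rw [e]
    nlinarith
  -- Here `A = a + b ^ 2`; the smooth part governed by `a` and the noise part governed by `b` will
  -- each take at most `ε / 2`.
  set a := L * D ^ 2 / ε with ha
  set b := s * D / ε with hb
  have ha0 : 0 ≤ a := by positivity
  have hb0 : 0 ≤ b := by positivity
  have hA' : A ≤ max 1 A := le_max_right _ _
  have hA1 : 1 ≤ max 1 A := le_max_left _ _
  have hq1 : (1 : ℝ) ≤ (1 + q) ^ 2 := one_le_pow₀ (by linarith)
  rw [h4] at hq
  have haq : K * a ≤ 1 / 2 * t ^ 2 := by
    have h5 : 4 * K ^ 2 * max 1 A * 1 ≤ 4 * K ^ 2 * max 1 A * (1 + q) ^ 2 := by gcongr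
    have h6 : a ≤ max 1 A := le_trans (by linarith [sq_nonneg b]) hA'
    have h7 : K * a ≤ K * max 1 A := by gcongr
    have h8 : 1 * (K * max 1 A) ≤ K * (K * max 1 A) := by gcongr; linarith
    have h9 : 0 ≤ K * (K * max 1 A) := by positivity
    linarith
  have hbq : K * (1 + q) * b ≤ 1 / 2 * t := by
    refine abs_le_of_sq_le_sq' (?_ : _ ≤ _) (by positivity) |>.2
    have h6 : b ^ 2 ≤ max 1 A := le_trans (by linarith) hA'
    have h7 := mul_le_mul_of_nonneg_left h6 (show 0 ≤ K ^ 2 * (1 + q) ^ 2 by positivity)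
    rw [mul_pow, mul_pow, mul_pow]
    linarith
  have eA : L * D ^ 2 / t ^ 2 = ε * (a / t ^ 2) := by rw [ha]; field_simp
  have eB : s * D / t = ε * (b / t) := by rw [hb]; field_simp
  have hX : K * (a / t ^ 2) ≤ 1 / 2 := by
    rw [← mul_div_assoc, div_le_iff₀ (by positivity)]; exact haq
  have hY : K * (1 + q) * (b / t) ≤ 1 / 2 := by
    rw [← mul_div_assoc, div_le_iff₀ ht0]; exact hbq
  have hX0 : 0 ≤ L * D ^ 2 / t ^ 2 := by positivity
  have hY0 : 0 ≤ s * D / t := by positivity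
  have hfin : D ^ 2 / (γ * (4 ^ q : ℕ)) + 170 * γ * s ^ 2 * (1 + q)
        + 8 / 3 * (s * D) * (1 / t) ≤ K * (L * D ^ 2 / t ^ 2) + K * (1 + q) * (s * D / t) := by
    have h8 : 0 ≤ 1 / c₁ * q * (s * D / t) := by positivity
    rw [hK]
    linarith
  refine hfin.trans ?_
  rw [eA, eB]
  have h9 := mul_le_mul_of_nonneg_left (add_le_add hX hY) hε.le
  linarith

end Parameters

end MarkovVI

end

open MeasureTheory ProbabilityTheory MarkovVI in
theorem mainTheorem11 :
    ∃ p : ℕ, ∀ c₁ c₂ : ℝ, 0 < c₁ → c₁ ≤ c₂ → c₂ ≤ 1 / 3 →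
    ∃ C : ℝ, 0 < C ∧
    ∀ L D σ Δ ε : ℝ, 0 < L → 0 < D → 0 ≤ σ → 0 ≤ Δ → 0 < ε →
    ∃ N : ℕ, 1 ≤ N ∧
    ∀ γ : ℝ, c₁ * stepScale L D σ Δ N ≤ γ → γ ≤ c₂ * stepScale L D σ Δ N →
    ∀ (d : ℕ) (S : Type*) [MeasurableSpace S] [StandardBorelSpace S]
      (Q : Kernel S S) [IsMarkovKernel Q] (π : Measure S) (τ : ℕ),
      UniformlyErgodic Q π τ →
    ∀ V : VIData d S, V.MonotoneSetting π L D σ Δ →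
    ∀ x0 ∈ V.X,
    ∀ (Ω : Type*) [MeasurableSpace Ω] (P : Measure Ω) [IsProbabilityMeasure P]
      (Z : ℕ → Ω → S) (J : ℕ → Ω → ℕ),
      IsMarkovChain Q P Z → IsGeometricSampling P J Z →
    let xbar : Ω → Vec d := fun ω =>
      averagedOutput V γ τ (Real.sqrt N) N x0 (fun n => Z n ω) (fun k => J k ω)
    let calls : Ω → ℝ := fun ω => oracleCalls τ (Real.sqrt N) N (fun k => J k ω)
    (Integrable (fun ω => V.gap (xbar ω)) P ∧ ∫ ω, V.gap (xbar ω) ∂P ≤ ε) ∧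
    (Integrable calls P ∧
      ∫ ω, calls ω ∂P ≤
        C * τ * max 1 (complexity L D σ Δ ε)
          * Real.log (2 + complexity L D σ Δ ε) ^ p) := by
  refine ⟨3, fun c₁ c₂ hc₁ hc₁₂ hc₂ => ?_⟩
  have hK : 1 ≤ 1 / c₁ + 60 := by
    have : 0 < 1 / c₁ := by positivity
    linarith
  obtain ⟨C, hC, hCq⟩ := exists_exponent hK
  refine ⟨C, hC, fun L D σ Δ ε hL hD _ _ hε => ?_⟩
  have hA0 : 0 ≤ complexity L D σ Δ ε := by rw [complexity_eq]; positivity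
  obtain ⟨q, hq, hqC⟩ := hCq _ hA0
  -- A power of four makes `√N = 2 ^ q`, so that the batch limit admits exactly the levels up to
  -- `q`.
  refine ⟨4 ^ q, Nat.one_le_pow _ _ (by norm_num), ?_⟩
  intro γ hlo hhi d S _ _ Q _ π τ hQ V hV x0 hx0 Ω _ P _ Z J hZ hJ xbar calls
  obtain ⟨hpos, hSL, -, -⟩ := stepScale_bounds (σ := σ) (Δ := Δ) hL hD q
  have hγ : 0 < γ := (mul_pos hc₁ hpos).trans_le hlo
  have hhi' : γ ≤ 1 / 3 * stepScale L D σ Δ (4 ^ q) :=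
    hhi.trans (mul_le_mul_of_nonneg_right hc₂ hpos.le)
  have hγL : γ * L ≤ 1 / 3 := by nlinarith
  have hM : ∀ l : ℕ, (2 : ℝ) ^ l ≤ Real.sqrt ((4 ^ q : ℕ) : ℝ) ↔ l ≤ q := fun l => by
    rw [sqrt_four_pow, pow_le_pow_iff_right₀ (by norm_num)]
  have hgap := integral_gap_le hV hD.le hL.le hγ hγL hx0 hQ hZ hJ hM
    (N := 4 ^ q) (Nat.one_le_pow _ _ (by norm_num))
  have hcalls := integral_oracleCalls_le hJ hM τ (4 ^ q)
  refine ⟨⟨hgap.1, hgap.2.trans (gap_bound_le hc₁ hL hD hε hlo hhi' hq)⟩, hcalls.1,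
    hcalls.2.trans ?_⟩
  have h1 := mul_le_mul_of_nonneg_left hqC (show (0 : ℝ) ≤ τ by positivity)
  push_cast
  linarith
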